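/- For a compact convex set $K\subset\mathbb{E}^3$ and a point $P\notin K$, let $\Omega(P)\subset S^2$ be the set of unit vectors $u$ such that the ray $\{P+tu : t\ge 0\}$ meets $K$, and let $|\Omega(P)|$ be its surface area (normalized by $|S^2|=4\pi$). Let $V$ be the volume of $K$ and $dP$ Lebesgue measure on $\mathbb{E}^3$. **Theorem.** For every compact convex set $K\subset\mathbb{E}^3$, the function $P\mapsto|\Omega(P)|^2$ is integrable on $\mathbb{E}^3\setminus K$ and $$\int_{P\notin K}|\Omega(P)|^2\,dP\;\ge\;4\pi^2V .$$ Equality holds if and only if $K$ is a closed ball of positive radius or $K$ is contained in a line (in the latter case both sides are $0$). -/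

import Mathlib

open MeasureTheory

/-- Euclidean three-space. -/
abbrev E3 : Type := EuclideanSpace ℝ (Fin 3)

/-- The unit sphere `S²` of Euclidean three-space. -/
abbrev S2 : Type := Metric.sphere (0 : E3) 1

/-- The (visual) solid angle of `K` from the point `P`: the set of unit directions `u` such that
the ray `P + t u`, `t ≥ 0`, meets `K`. -/
def solidAngle (K : Set E3) (P : E3) : Set S2 :=
  {u | ∃ t : ℝ, 0 ≤ t ∧ P + t • (u : E3) ∈ K}

/-- Surface area of a subset of the unit sphere (so that the whole sphere has area `4π`):
the spherical measure induced by Lebesgue measure in polar coordinates. -/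
noncomputable def sphereArea (A : Set S2) : ℝ :=
  ((volume : Measure E3).toSphere A).toReal

open Filter Topology
open scoped Pointwise

/-! The proof computes one integral in two ways. Let ω(P) be the measure of the lines through P that
meet K (`lineArea`, normalized so that all lines have measure 2π). Outside K, convexity makes ω(P) =
|Ω(P)|; inside K, ω(P) = 2π. Hence ∫ ω² over all of space is the wanted integral plus 4π²V
(`lintegral_lineArea_sq`).

On the other hand ω(P)² measures pairs of lines through P that both meet K. Two distinct concurrent
lines span a plane, and the Jacobian factors of this change of variables cancel: ∫ ω² is the
integral over all planes E of the square of the measure of the lines in E that meet K ∩ E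
(`lintegral_lineArea_sq_eq_planeWidth`). By Cauchy's formula that measure is, up to a density on
planes, the perimeter L of K ∩ E. The isoperimetric inequality L² ≥ 4πF, with F the area of K ∩ E,
together with Fubini for parallel sections, bounds the plane integral below by 4π · 2πV = 8π²V.
Subtracting 4π²V gives the theorem.

The isoperimetric inequality is proved with Fourier series. The area of a convex set is at most that
of each circumscribed equiangular 4m-gon; averaging over rotations and letting m tend to infinity
bounds it by π|c₀|² - π(k² - 1)|c_k|² for each k ≠ 0, where c_k are the Fourier coefficients of the
support function (`le_of_le_polygonArea`). Equality leaves only the modes |k| ≤ 1, that is, a disc.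

In the case of equality almost every plane section of K is isoperimetric. If K has interior, the
planes meeting the interior in a disc, if at all, are therefore dense among planes. Near a diameter
AB of K such discs are forced towards the disc with diameter AB, so K is the ball with diameter AB
(`exists_closedBall_of_dense`). If K has no interior and is not collinear, its solid angle is
positive off a plane while V = 0, so equality fails. -/

/-! ### Coordinates and iterated integrals in three-space -/

/-- The point of Euclidean three-space with the given coordinates. -/
def vec3 (x y z : ℝ) : E3 := !₂[x, y, z]

@[simp] lemma vec3_zero (x y z : ℝ) : vec3 x y z 0 = x := rfl
@[simp] lemma vec3_one (x y z : ℝ) : vec3 x y z 1 = y := rfl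
@[simp] lemma vec3_two (x y z : ℝ) : vec3 x y z 2 = z := rfl

lemma vec3_eta (P : E3) : vec3 (P 0) (P 1) (P 2) = P := by
  ext i; fin_cases i <;> rfl

lemma vec3_add (x y z x' y' z' : ℝ) :
    vec3 x y z + vec3 x' y' z' = vec3 (x + x') (y + y') (z + z') := by
  ext i; fin_cases i <;> rfl

lemma smul_vec3 (c x y z : ℝ) : c • vec3 x y z = vec3 (c * x) (c * y) (c * z) := by
  ext i; fin_cases i <;> rfl

lemma norm_vec3_sq (x y z : ℝ) : ‖vec3 x y z‖ ^ 2 = x ^ 2 + y ^ 2 + z ^ 2 := by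
  simp [EuclideanSpace.norm_sq_eq, Fin.sum_univ_three]

@[fun_prop]
lemma continuous_vec3 {X : Type*} [TopologicalSpace X] {f g h : X → ℝ} (hf : Continuous f)
    (hg : Continuous g) (hh : Continuous h) : Continuous fun x => vec3 (f x) (g x) (h x) := by
  refine (PiLp.continuous_toLp 2 _).comp (continuous_pi fun i => ?_)
  fin_cases i <;> simpa

@[fun_prop]
lemma measurable_vec3 {X : Type*} [MeasurableSpace X] {f g h : X → ℝ} (hf : Measurable f)
    (hg : Measurable g) (hh : Measurable h) : Measurable fun x => vec3 (f x) (g x) (h x) := by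
  have : Continuous fun p : ℝ × ℝ × ℝ => vec3 p.1 p.2.1 p.2.2 := by fun_prop
  exact this.measurable.comp (hf.prodMk (hg.prodMk hh))

lemma lintegral_E3 {f : E3 → ENNReal} (hf : Measurable f) :
    ∫⁻ P, f P = ∫⁻ x : ℝ, ∫⁻ y : ℝ, ∫⁻ z : ℝ, f (vec3 x y z) := by
  have h1 := (PiLp.volume_preserving_toLp (Fin 3)).lintegral_comp hf
  rw [← h1]
  have h2 := (volume_preserving_piFinSuccAbove (fun _ : Fin 3 => ℝ) 0).symm
  refine (h2.lintegral_comp (hf.comp (WithLp.measurable_toLp 2 _))).symm.trans ?_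
  rw [Measure.volume_eq_prod, lintegral_prod]
  swap
  · exact ((hf.comp (WithLp.measurable_toLp 2 _)).comp (MeasurableEquiv.measurable _)).aemeasurable
  refine lintegral_congr fun x => ?_
  have h3 := (volume_preserving_finTwoArrow ℝ).symm
  rw [← h3.lintegral_comp, Measure.volume_eq_prod, lintegral_prod]
  · refine lintegral_congr fun y => lintegral_congr fun z => ?_
    refine congrArg f ?_
    ext i; fin_cases i <;> rfl
  · refine Measurable.aemeasurable ?_
    refine ((hf.comp (WithLp.measurable_toLp 2 _)).comp (MeasurableEquiv.measurable _)).comp ?_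
    exact measurable_const.prodMk (MeasurableEquiv.measurable _)
  · refine ((hf.comp (WithLp.measurable_toLp 2 _)).comp (MeasurableEquiv.measurable _)).comp ?_
    exact measurable_const.prodMk measurable_id

lemma lintegral_eq_abs_mul_lintegral_comp_mul {a : ℝ} (ha : a ≠ 0) (f : ℝ → ENNReal) :
    ∫⁻ x, f x = ENNReal.ofReal |a| * ∫⁻ x, f (a * x) := by
  have h := lintegral_map_equiv (μ := volume) f (MeasurableEquiv.mulLeft₀ a ha)
  have h2 : Measure.map (⇑(MeasurableEquiv.mulLeft₀ a ha)) volume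
      = ENNReal.ofReal |a⁻¹| • (volume : Measure ℝ) := Real.map_volume_mul_left ha
  rw [h2, lintegral_smul_measure] at h
  simp only [MeasurableEquiv.coe_mulLeft₀, smul_eq_mul] at h
  rw [← h, ← mul_assoc, ← ENNReal.ofReal_mul (abs_nonneg _), ← abs_mul, mul_inv_cancel₀ ha]
  simp

lemma lintegral_eq_abs_mul_lintegral_affine {a : ℝ} (ha : a ≠ 0) (b : ℝ) (f : ℝ → ENNReal) :
    ∫⁻ x, f x = ENNReal.ofReal |a| * ∫⁻ x, f (a * x + b) := by
  rw [← lintegral_add_right_eq_self f b, lintegral_eq_abs_mul_lintegral_comp_mul ha]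

/-! ### Solid angles in the central chart of the sphere -/

/-- The lines `P + ℝ (1, s, t)` that meet `K`. -/
def lineHits (K : Set E3) : Set (E3 × ℝ × ℝ) :=
  {p | ∃ τ : ℝ, p.1 + τ • vec3 1 p.2.1 p.2.2 ∈ K}

/-- The first coordinate of the direction is 1, so the parameter of a hit X must be X₀ - P₀. This
exhibits the set as a projection of a closed set along the compact factor `K`. -/
lemma isClosed_lineHits {K : Set E3} (hK : IsCompact K) : IsClosed (lineHits K) := by
  have : CompactSpace K := isCompact_iff_compactSpace.1 hK
  have h : IsClosed {q : K × E3 × ℝ × ℝ |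
      q.2.1 + ((q.1 : E3) 0 - q.2.1 0) • vec3 1 q.2.2.1 q.2.2.2 = q.1} :=
    isClosed_eq (by fun_prop) (by fun_prop)
  convert isClosedMap_snd_of_compactSpace _ h using 1
  ext ⟨P, s, t⟩
  simp only [lineHits, Set.mem_ofPred_eq, Set.mem_image, Prod.exists, Subtype.exists]
  constructor
  · rintro ⟨τ, h⟩
    exact ⟨_, h, P, s, t, by simp, rfl⟩
  · rintro ⟨X, hX, P', s', t', h, h'⟩
    simp only [Prod.mk.injEq] at h'
    obtain ⟨rfl, rfl, rfl⟩ := h'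
    exact ⟨_, by rw [h]; exact hX⟩

/-- The density, as a function of the squared norm of a direction vector `(1, s, t)`, of surface
area in the central chart of the sphere. -/
noncomputable def chartWeight (v : ℝ) : ENNReal := ENNReal.ofReal ((√v)⁻¹ ^ 3)

@[fun_prop]
lemma measurable_chartWeight : Measurable chartWeight := by
  unfold chartWeight; fun_prop

/-- The indicator of `lineHits`. -/
noncomputable def hitInd (K : Set E3) (p : E3 × ℝ × ℝ) : ENNReal := (lineHits K).indicator 1 p

lemma measurable_hitInd {K : Set E3} (hK : IsCompact K) : Measurable (hitInd K) :=
  measurable_one.indicator (isClosed_lineHits hK).measurableSet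

/-- The area of the half sphere of directions `(1, s, t)` for which the line through `P` meets
`K`. -/
noncomputable def lineArea (K : Set E3) (P : E3) : ENNReal :=
  ∫⁻ s : ℝ, ∫⁻ t : ℝ, chartWeight (1 + s ^ 2 + t ^ 2) * hitInd K (P, s, t)

lemma lintegral_Ioo_sq {b : ℝ} (hb : 0 ≤ b) :
    ∫⁻ r in Set.Ioo 0 b, ENNReal.ofReal (r ^ 2) = ENNReal.ofReal (b ^ 3 / 3) := by
  rw [← ofReal_integral_eq_lintegral_ofReal]
  · rw [← integral_Ioc_eq_integral_Ioo, ← intervalIntegral.integral_of_le hb, integral_pow]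
    norm_num
  · exact ((continuous_pow 2).integrableOn_Icc (a := 0) (b := b)).mono_set Set.Ioo_subset_Icc_self
  · exact Filter.Eventually.of_forall fun x => sq_nonneg x

/-- Volume of the part of a cone in a half ball, in the central chart. -/
lemma volume_halfBall_cone {A : Set (ℝ × ℝ)} (hA : MeasurableSet A) :
    3 * volume {x : E3 | 0 < x 0 ∧ ‖x‖ < 1 ∧ (x 1 / x 0, x 2 / x 0) ∈ A} =
      ∫⁻ s : ℝ, ∫⁻ t : ℝ, chartWeight (1 + s ^ 2 + t ^ 2) * A.indicator 1 (s, t) := by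
  set C : Set E3 := {x : E3 | 0 < x 0 ∧ ‖x‖ < 1 ∧ (x 1 / x 0, x 2 / x 0) ∈ A}
  have hCmem : ∀ x, x ∈ C ↔ 0 < x 0 ∧ ‖x‖ < 1 ∧ (x 1 / x 0, x 2 / x 0) ∈ A := fun x => Iff.rfl
  have hmeas : MeasurableSet C := by
    have h1 : MeasurableSet {x : E3 | 0 < x 0} := measurableSet_lt (by fun_prop) (by fun_prop)
    have h2 : MeasurableSet {x : E3 | ‖x‖ < 1} := measurableSet_lt (by fun_prop) (by fun_prop)
    have h3 : Measurable fun x : E3 => (x 1 / x 0, x 2 / x 0) := by fun_prop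
    exact h1.inter (h2.inter (h3 hA))
  rw [← lintegral_indicator_one hmeas, lintegral_E3 (measurable_one.indicator hmeas)]
  set F : ℝ → ℝ → ℝ → ENNReal := fun r s t =>
    A.indicator 1 (s, t) * (Set.Ioo 0 (√(1 + s ^ 2 + t ^ 2))⁻¹).indicator
      (fun r => ENNReal.ofReal (r ^ 2)) r with hF
  have key : ∀ r : ℝ, (∫⁻ y : ℝ, ∫⁻ z : ℝ, C.indicator (1 : E3 → ENNReal) (vec3 r y z)) =
      ∫⁻ s : ℝ, ∫⁻ t : ℝ, F r s t := by
    intro r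
    rcases le_or_gt r 0 with hr | hr
    · rw [lintegral_congr fun s => lintegral_congr fun t => show F r s t = 0 by
        simp only [hF]
        have : r ∉ Set.Ioo 0 (√(1 + s ^ 2 + t ^ 2))⁻¹ := fun h => not_lt.2 hr h.1
        rw [Set.indicator_of_notMem this, mul_zero]]
      rw [lintegral_congr fun s => lintegral_congr fun t => Set.indicator_of_notMem
        (fun h => not_lt.2 hr ((hCmem _).1 h).1) _]
    -- Substituting y = rs, z = rt contributes r² and makes the cone condition independent of r.
    -- What remains of the ball is r < |(1, s, t)|⁻¹, and integrating r² up to there yields a third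
    -- of `chartWeight`.
    · rw [lintegral_eq_abs_mul_lintegral_comp_mul hr.ne']
      rw [lintegral_congr fun y => lintegral_eq_abs_mul_lintegral_comp_mul hr.ne' _]
      rw [lintegral_const_mul' _ _ ENNReal.ofReal_ne_top, ← mul_assoc,
        ← ENNReal.ofReal_mul (abs_nonneg _), ← lintegral_const_mul' _ _ ENNReal.ofReal_ne_top]
      refine lintegral_congr fun s => ?_
      rw [← lintegral_const_mul' _ _ ENNReal.ofReal_ne_top]
      refine lintegral_congr fun t => ?_
      have hn : ‖vec3 r (r * s) (r * t)‖ < 1 ↔ r < (√(1 + s ^ 2 + t ^ 2))⁻¹ := by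
        have e : vec3 r (r * s) (r * t) = r • vec3 1 s t := by rw [smul_vec3, mul_one]
        have e2 : ‖vec3 1 s t‖ = √(1 + s ^ 2 + t ^ 2) := by
          rw [← Real.sqrt_sq (norm_nonneg (vec3 1 s t)), norm_vec3_sq, one_pow]
        rw [e, norm_smul, e2, Real.norm_of_nonneg hr.le, lt_inv_comm₀ hr (by positivity),
          ← lt_div_iff₀' hr, one_div]
      have hv : vec3 r (r * s) (r * t) ∈ C ↔ r < (√(1 + s ^ 2 + t ^ 2))⁻¹ ∧ (s, t) ∈ A := by
        rw [hCmem, hn]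
        simp [hr, mul_div_cancel_left₀ _ hr.ne']
      classical
      simp only [hF, Set.indicator_apply, hv, hr, Set.mem_Ioo, true_and, Pi.one_apply]
      by_cases h1 : r < (√(1 + s ^ 2 + t ^ 2))⁻¹ <;> by_cases h2 : (s, t) ∈ A
      · simp [-inv_pow, h2, abs_of_pos hr, sq]
      all_goals simp [h1, h2]
  rw [lintegral_congr key]
  have hFm : Measurable fun p : ℝ × ℝ × ℝ => F p.1 p.2.1 p.2.2 := by
    refine Measurable.mul ((measurable_one.indicator hA).comp measurable_snd) ?_
    have : (fun p : ℝ × ℝ × ℝ => (Set.Ioo 0 (√(1 + p.2.1 ^ 2 + p.2.2 ^ 2))⁻¹).indicator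
      (fun r => ENNReal.ofReal (r ^ 2)) p.1) = {p : ℝ × ℝ × ℝ | 0 < p.1 ∧
        p.1 < (√(1 + p.2.1 ^ 2 + p.2.2 ^ 2))⁻¹}.indicator
          (fun p => ENNReal.ofReal (p.1 ^ 2)) := by
      ext p; simp [Set.indicator_apply]
    rw [this]
    have h1 : MeasurableSet {p : ℝ × ℝ × ℝ | 0 < p.1} :=
      measurableSet_lt (by fun_prop) (by fun_prop)
    have h2 : MeasurableSet {p : ℝ × ℝ × ℝ | p.1 < (√(1 + p.2.1 ^ 2 + p.2.2 ^ 2))⁻¹} :=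
      measurableSet_lt (by fun_prop) (by fun_prop)
    exact Measurable.indicator (by fun_prop) (h1.inter h2)
  rw [lintegral_lintegral_swap, ← lintegral_const_mul']
  rotate_left
  · simp
  · refine Measurable.aemeasurable ?_
    exact Measurable.lintegral_prod_right' (f := fun p : (ℝ × ℝ) × ℝ => F p.1.1 p.1.2 p.2)
      (hFm.comp (by fun_prop : Measurable fun p : (ℝ × ℝ) × ℝ => (p.1.1, p.1.2, p.2)))
  refine lintegral_congr fun s => ?_
  rw [lintegral_lintegral_swap, ← lintegral_const_mul' _ _ (by simp)]
  swap
  · exact (hFm.comp (by fun_prop : Measurable fun p : ℝ × ℝ => (p.1, s, p.2))).aemeasurable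
  refine lintegral_congr fun t => ?_
  have hne : A.indicator (1 : ℝ × ℝ → ENNReal) (s, t) ≠ ⊤ := by
    by_cases h : (s, t) ∈ A <;> simp [h]
  rw [lintegral_const_mul' _ _ hne, lintegral_indicator measurableSet_Ioo,
    lintegral_Ioo_sq (by positivity), chartWeight]
  rw [mul_left_comm, mul_comm (ENNReal.ofReal _)]
  congr 1
  rw [show (3 : ENNReal) = ENNReal.ofReal 3 by simp, ← ENNReal.ofReal_mul (by norm_num)]
  congr 1; ring

/-- A closed description of the directions `x` of the rays from `P` that meet `K`. -/
def rayHits (K : Set E3) (P : E3) : Set E3 := {x | ∃ X ∈ K, ‖x‖ • (X - P) = ‖X - P‖ • x}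

lemma isClosed_rayHits {K : Set E3} (hK : IsCompact K) (P : E3) : IsClosed (rayHits K P) := by
  have : CompactSpace K := isCompact_iff_compactSpace.1 hK
  have h : IsClosed {q : K × E3 | ‖q.2‖ • ((q.1 : E3) - P) = ‖(q.1 : E3) - P‖ • q.2} :=
    isClosed_eq (by fun_prop) (by fun_prop)
  convert isClosedMap_snd_of_compactSpace _ h using 1
  ext x
  simp only [rayHits, Set.mem_ofPred_eq, Set.mem_image, Prod.exists, Subtype.exists]
  constructor
  · rintro ⟨X, hX, h⟩
    exact ⟨X, hX, x, h, rfl⟩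
  · rintro ⟨X, hX, _, h, rfl⟩
    exact ⟨X, hX, h⟩

/-- The equation defining `rayHits` says that X - P and x point the same way without naming a
parameter t, which ranges over a noncompact set; this is what makes closedness a compactness
argument. -/
lemma mem_rayHits {K : Set E3} {P x : E3} (hx : x ≠ 0) :
    x ∈ rayHits K P ↔ ∃ t : ℝ, 0 ≤ t ∧ P + t • x ∈ K := by
  have hx' : ‖x‖ ≠ 0 := norm_ne_zero_iff.2 hx
  constructor
  · rintro ⟨X, hX, h⟩
    refine ⟨‖X - P‖ / ‖x‖, by positivity, ?_⟩
    rw [div_eq_inv_mul, ← smul_smul, ← h, smul_smul, inv_mul_cancel₀ hx', one_smul]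
    simpa
  · rintro ⟨t, ht, h⟩
    refine ⟨_, h, ?_⟩
    rw [add_sub_cancel_left, norm_smul, Real.norm_of_nonneg ht, smul_smul, mul_comm]

lemma solidAngle_eq_preimage (K : Set E3) (P : E3) :
    solidAngle K P = (↑) ⁻¹' rayHits K P := by
  ext u
  have : (u : E3) ≠ 0 := ne_zero_of_mem_unit_sphere u
  rw [Set.mem_preimage, mem_rayHits this]
  rfl

lemma measurableSet_solidAngle {K : Set E3} (hK : IsCompact K) (P : E3) :
    MeasurableSet (solidAngle K P) := by
  rw [solidAngle_eq_preimage]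
  exact (isClosed_rayHits hK P).measurableSet.preimage measurable_subtype_coe

lemma mem_cone_solidAngle {K : Set E3} {P x : E3} :
    x ∈ Set.Ioo (0 : ℝ) 1 • (Subtype.val '' solidAngle K P) ↔
      x ≠ 0 ∧ ‖x‖ < 1 ∧ ∃ t : ℝ, 0 ≤ t ∧ P + t • x ∈ K := by
  constructor
  · rintro ⟨r, hr, _, ⟨u, ⟨t, ht, hu⟩, rfl⟩, rfl⟩
    have hu1 : ‖(u : E3)‖ = 1 := by simp
    refine ⟨smul_ne_zero hr.1.ne' (ne_zero_of_mem_unit_sphere u), ?_, t / r,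
      div_nonneg ht hr.1.le, ?_⟩
    · simpa [norm_smul, abs_of_pos hr.1] using hr.2
    · simpa [smul_smul, div_mul_cancel₀ _ hr.1.ne'] using hu
  · rintro ⟨hx, hx1, t, ht, h⟩
    have hx' : ‖x‖ ≠ 0 := norm_ne_zero_iff.2 hx
    refine ⟨‖x‖, ⟨norm_pos_iff.2 hx, hx1⟩, ‖x‖⁻¹ • x, ⟨⟨‖x‖⁻¹ • x, ?_⟩, ⟨t * ‖x‖, by positivity, ?_⟩,
      rfl⟩, ?_⟩
    · simp [norm_smul, hx']
    · simpa [smul_smul, mul_assoc, hx'] using h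
    · simp [smul_smul, hx']

lemma volume_coord_eq_zero : volume {x : E3 | x 0 = 0} = 0 := by
  have hm : MeasurableSet {x : E3 | x 0 = 0} := measurableSet_eq_fun (by fun_prop) (by fun_prop)
  rw [← lintegral_indicator_one hm, lintegral_E3 (measurable_one.indicator hm)]
  rw [lintegral_eq_zero_iff']
  · filter_upwards [compl_mem_ae_iff.2 (measure_singleton (0 : ℝ))] with x hx
    have : ∀ y z, vec3 x y z ∉ {x : E3 | x 0 = 0} := fun y z h => hx h
    simp [this]
  · refine Measurable.aemeasurable ?_
    refine Measurable.lintegral_prod_right' (f := fun p : ℝ × ℝ => ∫⁻ z,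
      {x : E3 | x 0 = 0}.indicator (1 : E3 → ENNReal) (vec3 p.1 p.2 z)) ?_
    refine Measurable.lintegral_prod_right' (f := fun p : (ℝ × ℝ) × ℝ =>
      {x : E3 | x 0 = 0}.indicator (1 : E3 → ENNReal) (vec3 p.1.1 p.1.2 p.2)) ?_
    exact (measurable_one.indicator hm).comp (by fun_prop)

lemma mem_lineHits_of_pos {K : Set E3} {P x : E3} (hx : 0 < x 0) :
    (P, x 1 / x 0, x 2 / x 0) ∈ lineHits K ↔ ∃ t : ℝ, P + t • x ∈ K := by
  have e : vec3 1 (x 1 / x 0) (x 2 / x 0) = (x 0)⁻¹ • x := by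
    rw [← vec3_eta x, smul_vec3]
    simp [hx.ne', div_eq_inv_mul]
  simp only [lineHits, Set.mem_ofPred_eq, e, smul_smul]
  constructor
  · rintro ⟨τ, h⟩
    exact ⟨_, h⟩
  · rintro ⟨t, h⟩
    refine ⟨t * x 0, ?_⟩
    rwa [mul_assoc, mul_inv_cancel₀ hx.ne', mul_one]

lemma lineArea_eq_volume {K : Set E3} (hK : IsCompact K) (P : E3) :
    lineArea K P = 3 * volume {x : E3 | 0 < x 0 ∧ ‖x‖ < 1 ∧ ∃ t : ℝ, P + t • x ∈ K} := by
  have hA : MeasurableSet {p : ℝ × ℝ | (P, p) ∈ lineHits K} :=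
    (isClosed_lineHits hK).measurableSet.preimage (by fun_prop : Measurable fun p : ℝ × ℝ => (P, p))
  have h := volume_halfBall_cone hA
  have e : {x : E3 | 0 < x 0 ∧ ‖x‖ < 1 ∧ ∃ t : ℝ, P + t • x ∈ K} = {x : E3 | 0 < x 0 ∧ ‖x‖ < 1 ∧
      (x 1 / x 0, x 2 / x 0) ∈ {p : ℝ × ℝ | (P, p) ∈ lineHits K}} := by
    ext x
    simp only [Set.mem_ofPred_eq]
    refine and_congr_right fun hx => and_congr_right fun _ => (mem_lineHits_of_pos hx).symm
  rw [e, h]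
  rfl

lemma measurableSet_coord_pos : MeasurableSet {x : E3 | 0 < x 0} :=
  measurableSet_lt (by fun_prop) (by fun_prop)

/-- Splitting a set of vectors by the sign of the first coordinate. -/
lemma volume_eq_add_neg (C : Set E3) :
    volume C = volume (C ∩ {x | 0 < x 0}) + volume (-C ∩ {x | 0 < x 0}) := by
  rw [← measure_inter_add_sdiff C measurableSet_coord_pos]
  congr 1
  rw [← Measure.measure_neg]
  refine le_antisymm ?_ (measure_mono ?_)
  · refine (measure_mono (t := (-C ∩ {x | 0 < x 0}) ∪ {x : E3 | x 0 = 0}) ?_).trans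
      ((measure_union_le _ _).trans (by rw [volume_coord_eq_zero, add_zero]))
    rintro x ⟨hx, hx0⟩
    have h0 : ¬ 0 < (-x) 0 := hx0
    rcases eq_or_ne (x 0) 0 with h | h
    · exact Or.inr h
    · refine Or.inl ⟨hx, ?_⟩
      have : (-x) 0 = - x 0 := rfl
      rw [this] at h0
      exact lt_of_le_of_ne (by linarith) h.symm
  · rintro x ⟨hx, hx0⟩
    refine ⟨hx, fun h => ?_⟩
    have h1 : 0 < (-x) 0 := h
    have h2 : 0 < x 0 := hx0
    have : (-x) 0 = - x 0 := rfl
    linarith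

/-- If both opposite rays from P met K, convexity would put P in K. So the solid angle and its
antipode are disjoint, and folding it onto the half sphere of positive first coordinate loses no
area. Areas are computed as 3 times the volume of the cone in the unit ball. -/
lemma toSphere_solidAngle {K : Set E3} (hK : IsCompact K) (hconv : Convex ℝ K) {P : E3}
    (hP : P ∉ K) : (volume : Measure E3).toSphere (solidAngle K P) = lineArea K P := by
  rw [Measure.toSphere_apply' _ (measurableSet_solidAngle hK P), lineArea_eq_volume hK,
    volume_eq_add_neg, finrank_euclideanSpace_fin]
  push_cast
  congr 1
  rw [← measure_union']
  · congr 1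
    ext x
    simp only [Set.mem_union, Set.mem_inter_iff, mem_cone_solidAngle, Set.mem_ofPred_eq,
      Set.mem_neg, norm_neg, smul_neg]
    constructor
    · rintro (⟨⟨-, h1, t, -, h⟩, h0⟩ | ⟨⟨-, h1, t, -, h⟩, h0⟩)
      · exact ⟨h0, h1, t, h⟩
      · exact ⟨h0, h1, -t, by simpa using h⟩
    · rintro ⟨h0, h1, t, h⟩
      have hx : x ≠ 0 := by rintro rfl; simp at h0
      rcases le_total 0 t with ht | ht
      · exact Or.inl ⟨⟨hx, h1, t, ht, h⟩, h0⟩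
      · exact Or.inr ⟨⟨neg_ne_zero.2 hx, h1, -t, by linarith, by simpa using h⟩, h0⟩
  · rw [Set.disjoint_left]
    rintro x ⟨hx, -⟩ ⟨hx', -⟩
    obtain ⟨-, -, t, ht, h⟩ := mem_cone_solidAngle.1 hx
    obtain ⟨-, -, t', ht', h'⟩ := mem_cone_solidAngle.1 (Set.mem_neg.1 hx')
    rcases eq_or_lt_of_le (add_nonneg ht ht') with h0 | h0
    · have : t = 0 := by linarith
      simp [this] at h
      exact hP h
    · apply hP
      convert hconv h h' (div_nonneg ht' h0.le) (div_nonneg ht h0.le) (by field_simp; ring) using 1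
      have : (t' / (t + t')) • P + (t / (t + t')) • P = P := by
        rw [← add_smul]
        convert one_smul ℝ P using 2
        field_simp; ring
      rw [smul_add, smul_add, smul_neg, smul_neg, smul_smul, smul_smul,
        show t' / (t + t') * t = t / (t + t') * t' by ring]
      nth_rewrite 1 [← this]
      abel
  · have e : Set.Ioo (0 : ℝ) 1 • (Subtype.val '' solidAngle K P) ∩ {x | 0 < x 0} =
        (Metric.ball 0 1 ∩ rayHits K P) ∩ {x | 0 < x 0} := by
      ext x
      simp only [Set.mem_inter_iff, mem_cone_solidAngle, Metric.mem_ball, dist_zero_right]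
      refine and_congr_left fun h0 => ?_
      have hx : x ≠ 0 := by rintro rfl; simp at h0
      simp [hx, mem_rayHits hx]
    rw [e]
    exact (measurableSet_ball.inter (isClosed_rayHits hK P).measurableSet).inter
      measurableSet_coord_pos

lemma volume_halfBall : 3 * volume {x : E3 | 0 < x 0 ∧ ‖x‖ < 1} = ENNReal.ofReal (2 * Real.pi) := by
  have h := volume_eq_add_neg (Metric.ball 0 1)
  have e1 : Metric.ball (0 : E3) 1 ∩ {x | 0 < x 0} = {x : E3 | 0 < x 0 ∧ ‖x‖ < 1} := by
    ext x; simp [and_comm]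
  have e2 : -Metric.ball (0 : E3) 1 = Metric.ball 0 1 := by ext x; simp
  rw [e2, e1, EuclideanSpace.volume_ball_fin_three, ← two_mul] at h
  have h3 : (2 : ENNReal) * (3 * volume {x : E3 | 0 < x 0 ∧ ‖x‖ < 1}) =
      2 * ENNReal.ofReal (2 * Real.pi) := by
    rw [mul_left_comm, ← h]
    rw [show (3 : ENNReal) = ENNReal.ofReal 3 by simp, show (2 : ENNReal) = ENNReal.ofReal 2 by simp,
      ENNReal.ofReal_one, one_pow, one_mul, ← ENNReal.ofReal_mul (by norm_num),
      ← ENNReal.ofReal_mul (by norm_num)]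
    congr 1; ring
  exact (ENNReal.mul_right_inj (by simp) (by simp)).1 h3

lemma lineArea_of_mem {K : Set E3} (hK : IsCompact K) {P : E3} (hP : P ∈ K) :
    lineArea K P = ENNReal.ofReal (2 * Real.pi) := by
  rw [lineArea_eq_volume hK, ← volume_halfBall]
  congr 2
  ext x
  simp only [Set.mem_ofPred_eq]
  refine and_congr_right fun _ => and_iff_left ⟨0, by simpa⟩

lemma lintegral_chartWeight :
    ∫⁻ s : ℝ, ∫⁻ t : ℝ, chartWeight (1 + s ^ 2 + t ^ 2) = ENNReal.ofReal (2 * Real.pi) := by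
  have h := volume_halfBall_cone MeasurableSet.univ
  simpa [volume_halfBall] using h.symm

lemma measurable_lineArea {K : Set E3} (hK : IsCompact K) : Measurable (lineArea K) := by
  refine Measurable.lintegral_prod_right' (f := fun p : E3 × ℝ => ∫⁻ t : ℝ,
    chartWeight (1 + p.2 ^ 2 + t ^ 2) * hitInd K (p.1, p.2, t)) ?_
  refine Measurable.lintegral_prod_right' (f := fun p : (E3 × ℝ) × ℝ =>
    chartWeight (1 + p.1.2 ^ 2 + p.2 ^ 2) * hitInd K (p.1.1, p.1.2, p.2)) ?_
  exact Measurable.mul (by fun_prop) ((measurable_hitInd hK).comp (by fun_prop))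

/-- Inside K the integrand is the constant (2π)²; this is the term subtracted at the end. -/
lemma lintegral_lineArea_sq {K : Set E3} (hK : IsCompact K) (hconv : Convex ℝ K) :
    ∫⁻ P, lineArea K P ^ 2 = (∫⁻ P in Kᶜ, ENNReal.ofReal (sphereArea (solidAngle K P) ^ 2)) +
      ENNReal.ofReal (4 * Real.pi ^ 2) * volume K := by
  have hm : MeasurableSet K := hK.measurableSet
  rw [← lintegral_add_compl _ hm, add_comm]
  congr 1
  · refine setLIntegral_congr_fun hm.compl fun P hP => ?_
    simp only [sphereArea]
    rw [ENNReal.ofReal_pow ENNReal.toReal_nonneg, ENNReal.ofReal_toReal (measure_ne_top _ _),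
      toSphere_solidAngle hK hconv hP]
  · rw [← setLIntegral_const]
    refine setLIntegral_congr_fun hm fun P hP => ?_
    rw [lineArea_of_mem hK hP, ← ENNReal.ofReal_pow (by positivity)]
    congr 1; ring

/-! ### Pairs of concurrent lines and the planes they span -/

/-- Directions (1, s₁, t₁) and (1, s₂, t₂) with s₁ ≠ s₂ lie in exactly one plane direction z = βx +
αy, given by tᵢ = αsᵢ + β; the Jacobian is |s₁ - s₂|. -/
lemma lintegral_pair_eq_abs_mul {s₁ s₂ : ℝ} (h : s₁ ≠ s₂) {g : ℝ → ℝ → ENNReal}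
    (hg : Measurable (Function.uncurry g)) :
    ∫⁻ t₁, ∫⁻ t₂, g t₁ t₂ =
      ENNReal.ofReal |s₁ - s₂| * ∫⁻ α : ℝ, ∫⁻ β : ℝ, g (α * s₁ + β) (α * s₂ + β) := by
  have hg' : ∀ {f₁ f₂ : ℝ × ℝ → ℝ}, Measurable f₁ → Measurable f₂ →
      Measurable fun p => g (f₁ p) (f₂ p) := fun h₁ h₂ => hg.comp (h₁.prodMk h₂)
  rw [lintegral_lintegral_swap hg.aemeasurable]
  rw [lintegral_congr fun t₂ => lintegral_eq_abs_mul_lintegral_affine (sub_ne_zero.2 h) t₂ _]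
  rw [lintegral_const_mul' _ _ ENNReal.ofReal_ne_top, lintegral_lintegral_swap]
  swap
  · exact (hg' (f₁ := fun p => (s₁ - s₂) * p.2 + p.1) (f₂ := fun p => p.1)
      (by fun_prop) (by fun_prop)).aemeasurable
  congr 1
  refine lintegral_congr fun α => ?_
  rw [← lintegral_add_right_eq_self _ (α * s₂)]
  refine lintegral_congr fun β => ?_
  congr 1 <;> ring

/-- A point of the plane is determined by the intercepts of the lines of slopes s₁ and s₂ through
it. The factor |s₁ - s₂| consumed here is the one produced by `lintegral_pair_eq_abs_mul`. -/
lemma lintegral_pair_intercepts {s₁ s₂ : ℝ} (h : s₁ ≠ s₂) {g₁ g₂ : ℝ → ENNReal}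
    (hg₁ : Measurable g₁) (hg₂ : Measurable g₂) :
    ENNReal.ofReal |s₁ - s₂| * ∫⁻ x : ℝ, ∫⁻ y : ℝ, g₁ (y - s₁ * x) * g₂ (y - s₂ * x) =
      (∫⁻ q, g₁ q) * ∫⁻ q, g₂ q := by
  rw [← lintegral_lintegral_mul hg₁.aemeasurable hg₂.aemeasurable,
    lintegral_pair_eq_abs_mul (neg_injective.ne h) (g := fun q₁ q₂ => g₁ q₁ * g₂ q₂)
      ((hg₁.comp measurable_fst).mul (hg₂.comp measurable_snd))]
  congr 2
  · rw [neg_sub_neg, abs_sub_comm]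
  · ext x
    refine lintegral_congr fun y => ?_
    congr 2 <;> ring

/-- The measure of the lines of slope `s` in the plane `z = c + β x + α y` that meet `K`. -/
noncomputable def slopeWidth (K : Set E3) (α β c s : ℝ) : ENNReal :=
  ∫⁻ q : ℝ, chartWeight (1 + s ^ 2 + (α * s + β) ^ 2) *
    hitInd K (vec3 0 q (c + α * q), s, α * s + β)

/-- The measure of the lines in the plane `z = c + β x + α y` that meet `K`. -/
noncomputable def planeWidth (K : Set E3) (p : ℝ × ℝ × ℝ) : ENNReal :=
  ∫⁻ s : ℝ, slopeWidth K p.1 p.2.1 p.2.2 s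

lemma hitInd_add_smul (K : Set E3) (P : E3) (τ s t : ℝ) :
    hitInd K (P + τ • vec3 1 s t, s, t) = hitInd K (P, s, t) := by
  have : (P + τ • vec3 1 s t, s, t) ∈ lineHits K ↔ (P, s, t) ∈ lineHits K := by
    simp only [lineHits, Set.mem_ofPred_eq, add_assoc, ← add_smul]
    exact ⟨fun ⟨a, h⟩ => ⟨_, h⟩, fun ⟨a, h⟩ => ⟨a - τ, by simpa⟩⟩
  classical
  simp only [hitInd, Set.indicator_apply, this, Pi.one_apply]

/-- Whether a line meets K does not depend on the point chosen on it, so the point is slid along the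
line to x = 0. -/
lemma hitInd_plane (K : Set E3) (α β c x y s : ℝ) :
    hitInd K (vec3 x y (c + β * x + α * y), s, α * s + β) =
      hitInd K (vec3 0 (y - s * x) (c + α * (y - s * x)), s, α * s + β) := by
  rw [← hitInd_add_smul K (vec3 0 (y - s * x) _) x, smul_vec3, vec3_add]
  congr 3 <;> ring

/-- Here (P, t₁, t₂) is traded for (α, β, c, q₁, q₂): the plane through both lines and their
intercepts in it. The two Jacobians cancel, and for a fixed plane the integrand factors. -/
lemma lintegral_pair_hitInd {K : Set E3} (hK : IsCompact K) {s₁ s₂ : ℝ} (h : s₁ ≠ s₂) :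
    ∫⁻ P, ∫⁻ t₁, ∫⁻ t₂, (chartWeight (1 + s₁ ^ 2 + t₁ ^ 2) * hitInd K (P, s₁, t₁)) *
      (chartWeight (1 + s₂ ^ 2 + t₂ ^ 2) * hitInd K (P, s₂, t₂)) =
    ∫⁻ p : ℝ × ℝ × ℝ, slopeWidth K p.1 p.2.1 p.2.2 s₁ * slopeWidth K p.1 p.2.1 p.2.2 s₂ := by
  set G : E3 → ℝ → ℝ → ENNReal := fun P s t => chartWeight (1 + s ^ 2 + t ^ 2) * hitInd K (P, s, t)
  have hG : ∀ {X : Type} [MeasurableSpace X] {a : X → E3} {b c : X → ℝ}, Measurable a →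
      Measurable b → Measurable c → Measurable fun x => G (a x) (b x) (c x) := by
    intro X _ a b c ha hb hc
    exact Measurable.mul (by fun_prop) ((measurable_hitInd hK).comp (ha.prodMk (hb.prodMk hc)))
  have hinner : ∀ α β : ℝ, ENNReal.ofReal |s₁ - s₂| *
      ∫⁻ P, G P s₁ (α * s₁ + β) * G P s₂ (α * s₂ + β) =
      ∫⁻ c : ℝ, slopeWidth K α β c s₁ * slopeWidth K α β c s₂ := by
    intro α β
    have hm1 : Measurable fun P : E3 => G P s₁ (α * s₁ + β) * G P s₂ (α * s₂ + β) :=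
      (hG measurable_id measurable_const measurable_const).mul
        (hG measurable_id measurable_const measurable_const)
    rw [lintegral_E3 hm1]
    -- The shear z = c + βx + αy turns the height of P into the parameter c of the plane through P.
    rw [lintegral_congr fun x => lintegral_congr fun y =>
      (lintegral_add_right_eq_self _ (β * x + α * y)).symm]
    have hm2 : Measurable fun q : (ℝ × ℝ) × ℝ =>
        G (vec3 q.1.1 q.1.2 (q.2 + (β * q.1.1 + α * q.1.2))) s₁ (α * s₁ + β) *
          G (vec3 q.1.1 q.1.2 (q.2 + (β * q.1.1 + α * q.1.2))) s₂ (α * s₂ + β) :=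
      (hG (by fun_prop) (by fun_prop) (by fun_prop)).mul
        (hG (by fun_prop) (by fun_prop) (by fun_prop))
    rw [lintegral_congr fun x => lintegral_lintegral_swap (f := fun y z =>
      G (vec3 x y (z + (β * x + α * y))) s₁ (α * s₁ + β) *
        G (vec3 x y (z + (β * x + α * y))) s₂ (α * s₂ + β))
      (hm2.comp (by fun_prop : Measurable fun r : ℝ × ℝ => ((x, r.1), r.2))).aemeasurable]
    rw [lintegral_lintegral_swap, ← lintegral_const_mul' _ _ ENNReal.ofReal_ne_top]
    swap
    · refine Measurable.aemeasurable ?_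
      exact Measurable.lintegral_prod_right'
        (hm2.comp (by fun_prop : Measurable fun r : (ℝ × ℝ) × ℝ => ((r.1.1, r.2), r.1.2)))
    refine lintegral_congr fun c => ?_
    have hg : ∀ s : ℝ, Measurable fun q : ℝ => G (vec3 0 q (c + α * q)) s (α * s + β) :=
      fun s => hG (by fun_prop) (by fun_prop) (by fun_prop)
    refine Eq.trans ?_ (lintegral_pair_intercepts h (hg s₁) (hg s₂))
    congr 1
    refine lintegral_congr fun x => lintegral_congr fun y => ?_
    simp only [G]
    rw [← hitInd_plane, ← hitInd_plane, add_assoc c]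
  rw [lintegral_congr fun P => lintegral_pair_eq_abs_mul h (g := fun t₁ t₂ => G P s₁ t₁ * G P s₂ t₂)
    ((hG measurable_const measurable_const measurable_fst).mul
      (hG measurable_const measurable_const measurable_snd))]
  have hm : Measurable fun q : (E3 × ℝ) × ℝ =>
      G q.1.1 s₁ (q.1.2 * s₁ + q.2) * G q.1.1 s₂ (q.1.2 * s₂ + q.2) :=
    (hG (by fun_prop) (by fun_prop) (by fun_prop)).mul
      (hG (by fun_prop) (by fun_prop) (by fun_prop))
  rw [lintegral_const_mul' _ _ ENNReal.ofReal_ne_top, lintegral_lintegral_swap]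
  swap
  · exact (Measurable.lintegral_prod_right' hm).aemeasurable
  rw [lintegral_congr fun α => lintegral_lintegral_swap
    (f := fun P β => G P s₁ (α * s₁ + β) * G P s₂ (α * s₂ + β))
    (hm.comp (by fun_prop : Measurable fun r : E3 × ℝ => ((r.1, α), r.2))).aemeasurable]
  rw [← lintegral_const_mul' _ _ ENNReal.ofReal_ne_top]
  rw [lintegral_congr fun α => (lintegral_const_mul' _ _ ENNReal.ofReal_ne_top).symm]
  rw [lintegral_congr fun α => lintegral_congr fun β => hinner α β]
  have hs : ∀ s : ℝ, Measurable fun p : ℝ × ℝ × ℝ => slopeWidth K p.1 p.2.1 p.2.2 s := by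
    intro s
    refine Measurable.lintegral_prod_right' (f := fun r : (ℝ × ℝ × ℝ) × ℝ =>
      G (vec3 0 r.2 (r.1.2.2 + r.1.1 * r.2)) s (r.1.1 * s + r.1.2.1)) ?_
    exact hG (by fun_prop) (by fun_prop) (by fun_prop)
  have hs2 : Measurable fun p : ℝ × ℝ × ℝ =>
      slopeWidth K p.1 p.2.1 p.2.2 s₁ * slopeWidth K p.1 p.2.1 p.2.2 s₂ := (hs s₁).mul (hs s₂)
  rw [Measure.volume_eq_prod, lintegral_prod _ hs2.aemeasurable]
  refine lintegral_congr fun α => ?_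
  rw [Measure.volume_eq_prod, lintegral_prod]
  exact (hs2.comp (measurable_const.prodMk measurable_id)).aemeasurable

lemma measurable_slopeWidth {K : Set E3} (hK : IsCompact K) :
    Measurable fun r : (ℝ × ℝ × ℝ) × ℝ => slopeWidth K r.1.1 r.1.2.1 r.1.2.2 r.2 := by
  refine Measurable.lintegral_prod_right' (f := fun w : ((ℝ × ℝ × ℝ) × ℝ) × ℝ =>
    chartWeight (1 + w.1.2 ^ 2 + (w.1.1.1 * w.1.2 + w.1.1.2.1) ^ 2) *
      hitInd K (vec3 0 w.2 (w.1.1.2.2 + w.1.1.1 * w.2), w.1.2, w.1.1.1 * w.1.2 + w.1.1.2.1)) ?_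
  exact Measurable.mul (by fun_prop) ((measurable_hitInd hK).comp (by fun_prop))

lemma measurable_planeWidth {K : Set E3} (hK : IsCompact K) : Measurable (planeWidth K) :=
  (measurable_slopeWidth hK).lintegral_prod_right'

lemma lintegral_sq_eq_lintegral_pair {Y : Type*} [MeasurableSpace Y] {μ : Measure Y} [SFinite μ]
    {W : Y → ℝ → ENNReal} (hW : Measurable fun p : Y × ℝ => W p.1 p.2) :
    ∫⁻ y, (∫⁻ s, W y s) ^ 2 ∂μ = ∫⁻ s₁, ∫⁻ s₂, ∫⁻ y, W y s₁ * W y s₂ ∂μ := by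
  have hW2 : Measurable fun w : (Y × ℝ) × ℝ => W w.1.1 w.1.2 * W w.1.1 w.2 :=
    (hW.comp measurable_fst).mul
      (hW.comp ((measurable_fst.comp measurable_fst).prodMk measurable_snd))
  have hy : ∀ y, Measurable (W y) := fun y => hW.comp (measurable_prodMk_left (x := y))
  have e : ∀ y, (∫⁻ s, W y s) ^ 2 = ∫⁻ s₁, ∫⁻ s₂, W y s₁ * W y s₂ := fun y => by
    rw [sq, lintegral_lintegral_mul (hy y).aemeasurable (hy y).aemeasurable]
  rw [lintegral_congr e]
  rw [lintegral_lintegral_swap (f := fun y s₁ => ∫⁻ s₂, W y s₁ * W y s₂)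
    (hW2.lintegral_prod_right').aemeasurable]
  refine lintegral_congr fun s₁ => ?_
  refine lintegral_lintegral_swap (f := fun y s₂ => W y s₁ * W y s₂) (Measurable.aemeasurable ?_)
  exact (hW.comp (measurable_fst.prodMk measurable_const)).mul hW

lemma lintegral_lineArea_sq_eq_planeWidth {K : Set E3} (hK : IsCompact K) :
    ∫⁻ P, lineArea K P ^ 2 = ∫⁻ p, planeWidth K p ^ 2 := by
  have hm : Measurable fun w : (E3 × ℝ) × ℝ =>
      chartWeight (1 + w.1.2 ^ 2 + w.2 ^ 2) * hitInd K (w.1.1, w.1.2, w.2) :=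
    Measurable.mul (by fun_prop) ((measurable_hitInd hK).comp (by fun_prop))
  have e1 := lintegral_sq_eq_lintegral_pair (μ := (volume : Measure E3)) (W := fun P s =>
    ∫⁻ t, chartWeight (1 + s ^ 2 + t ^ 2) * hitInd K (P, s, t)) hm.lintegral_prod_right'
  have e2 := lintegral_sq_eq_lintegral_pair (μ := (volume : Measure (ℝ × ℝ × ℝ)))
    (W := fun p s => slopeWidth K p.1 p.2.1 p.2.2 s) (measurable_slopeWidth hK)
  refine e1.trans (Eq.trans ?_ e2.symm)
  refine lintegral_congr fun s₁ => lintegral_congr_ae ?_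
  -- Pairs of equal slopes do not determine α and β, but they form a null set.
  filter_upwards [compl_mem_ae_iff.2 (measure_singleton s₁)] with s₂ h
  rw [← lintegral_pair_hitInd hK (Ne.symm h)]
  refine lintegral_congr fun P => ?_
  have hPt : ∀ s, Measurable fun t => chartWeight (1 + s ^ 2 + t ^ 2) * hitInd K (P, s, t) :=
    fun s => Measurable.mul (by fun_prop) ((measurable_hitInd hK).comp (by fun_prop))
  exact (lintegral_lintegral_mul (hPt s₁).aemeasurable (hPt s₂).aemeasurable).symm

/-! ### Plane sections in orthonormal coordinates -/

/-- The point with orthonormal coordinates `p` in the plane `z = c + β x + α y`. -/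
noncomputable def planePoint (α β c : ℝ) (p : ℝ × ℝ) : E3 :=
  vec3 (√(1 + α ^ 2) / √(1 + α ^ 2 + β ^ 2) * p.1)
    (1 / √(1 + α ^ 2) * p.2 + -(α * β / (√(1 + α ^ 2) * √(1 + α ^ 2 + β ^ 2)) * p.1))
    (c + β * (√(1 + α ^ 2) / √(1 + α ^ 2 + β ^ 2) * p.1) +
      α * (1 / √(1 + α ^ 2) * p.2 + -(α * β / (√(1 + α ^ 2) * √(1 + α ^ 2 + β ^ 2)) * p.1)))

/-- The inverse of `planePoint` on the plane. -/
noncomputable def planeCoord (α β : ℝ) (X : E3) : ℝ × ℝ :=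
  (√(1 + α ^ 2 + β ^ 2) / √(1 + α ^ 2) * X 0, √(1 + α ^ 2) * X 1 + α * β / √(1 + α ^ 2) * X 0)

lemma planeCoord_planePoint (α β c : ℝ) (p : ℝ × ℝ) :
    planeCoord α β (planePoint α β c p) = p := by
  have hj : 0 < √(1 + α ^ 2) := by positivity
  have hD : 0 < √(1 + α ^ 2 + β ^ 2) := by positivity
  ext <;> simp only [planeCoord, planePoint, vec3_zero, vec3_one] <;> field_simp
  ring

lemma planePoint_planeCoord {α β c : ℝ} {X : E3} (hX : X 2 = c + β * X 0 + α * X 1) :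
    planePoint α β c (planeCoord α β X) = X := by
  have hj : 0 < √(1 + α ^ 2) := by positivity
  have hD : 0 < √(1 + α ^ 2 + β ^ 2) := by positivity
  have e0 : √(1 + α ^ 2) / √(1 + α ^ 2 + β ^ 2) * (planeCoord α β X).1 = X 0 := by
    simp only [planeCoord]; field_simp
  have e1 : 1 / √(1 + α ^ 2) * (planeCoord α β X).2 +
      -(α * β / (√(1 + α ^ 2) * √(1 + α ^ 2 + β ^ 2)) * (planeCoord α β X).1) = X 1 := by
    simp only [planeCoord]; field_simp; ring
  rw [planePoint, e0, e1, ← hX, vec3_eta]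

lemma planePoint_mem_plane (α β c : ℝ) (p : ℝ × ℝ) :
    (planePoint α β c p) 2 = c + β * (planePoint α β c p) 0 + α * (planePoint α β c p) 1 := rfl

lemma norm_planePoint_sub_sq (α β c : ℝ) (p q : ℝ × ℝ) :
    ‖planePoint α β c p - planePoint α β c q‖ ^ 2 = (p.1 - q.1) ^ 2 + (p.2 - q.2) ^ 2 := by
  have hj : √(1 + α ^ 2) ^ 2 = 1 + α ^ 2 := Real.sq_sqrt (by positivity)
  have hD : √(1 + α ^ 2 + β ^ 2) ^ 2 = 1 + α ^ 2 + β ^ 2 := Real.sq_sqrt (by positivity)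
  have hj0 : 0 < √(1 + α ^ 2) := by positivity
  have hD0 : 0 < √(1 + α ^ 2 + β ^ 2) := by positivity
  simp only [EuclideanSpace.norm_sq_eq, Fin.sum_univ_three, planePoint, PiLp.sub_apply, vec3_zero,
    vec3_one, vec3_two, Real.norm_eq_abs, sq_abs]
  generalize √(1 + α ^ 2) = j at *
  generalize √(1 + α ^ 2 + β ^ 2) = D at *
  have hD' : D ^ 2 = j ^ 2 + β ^ 2 := by rw [hD, hj]
  have ha : α ^ 2 = j ^ 2 - 1 := by linarith
  field_simp
  obtain ⟨a, b⟩ := p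
  obtain ⟨a', b'⟩ := q
  simp only
  have h4 : α ^ 4 = (j ^ 2 - 1) ^ 2 := by rw [← ha]; ring
  have h3 : α ^ 3 = α * (j ^ 2 - 1) := by rw [← ha]; ring
  ring_nf
  simp only [ha, h3, h4, hD']
  ring_nf

@[fun_prop]
lemma continuous_planePoint (α β c : ℝ) : Continuous (planePoint α β c) := by
  unfold planePoint; fun_prop

lemma continuous_planeCoord (α β : ℝ) : Continuous (planeCoord α β) := by
  unfold planeCoord; fun_prop

/-- The section of `K` by the plane `z = c + β x + α y`, in orthonormal coordinates. -/
def planeSection (K : Set E3) (α β c : ℝ) : Set (ℝ × ℝ) := planePoint α β c ⁻¹' K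

lemma isCompact_planeSection {K : Set E3} (hK : IsCompact K) (α β c : ℝ) :
    IsCompact (planeSection K α β c) := by
  refine (hK.image (continuous_planeCoord α β)).of_isClosed_subset
    (hK.isClosed.preimage (continuous_planePoint α β c)) fun p hp => ?_
  exact ⟨_, hp, planeCoord_planePoint α β c p⟩

lemma planePoint_combo (α β c : ℝ) (p q : ℝ × ℝ) {a b : ℝ} (h : a + b = 1) :
    planePoint α β c (a • p + b • q) = a • planePoint α β c p + b • planePoint α β c q := by
  simp only [planePoint, smul_vec3, vec3_add, Prod.fst_add, Prod.snd_add, Prod.smul_fst,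
    Prod.smul_snd, smul_eq_mul]
  obtain rfl : b = 1 - a := by linarith
  congr 1 <;> ring

lemma convex_planeSection {K : Set E3} (hK : Convex ℝ K) (α β c : ℝ) :
    Convex ℝ (planeSection K α β c) := by
  intro p hp q hq a b ha hb hab
  simp only [planeSection, Set.mem_preimage, planePoint_combo α β c p q hab]
  exact hK hp hq ha hb hab

/-- The lines of slope `σ` in the coordinate plane that meet `S`, by intercept. -/
def lineIntercepts (S : Set (ℝ × ℝ)) (σ : ℝ) : Set ℝ := (fun p => p.2 - σ * p.1) '' S

/-- The measure of the lines in the coordinate plane that meet `S`. -/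
noncomputable def linesMeasure (S : Set (ℝ × ℝ)) : ENNReal :=
  ∫⁻ σ : ℝ, chartWeight (1 + σ ^ 2) * volume (lineIntercepts S σ)

lemma isCompact_lineIntercepts {S : Set (ℝ × ℝ)} (hS : IsCompact S) (σ : ℝ) :
    IsCompact (lineIntercepts S σ) := hS.image (by fun_prop)

/-- The second orthonormal axis is (0, 1, α)/√(1 + α²), so the line x = 0 of the plane becomes the
vertical axis. Intercepts are therefore only rescaled, and slopes change affinely. -/
lemma mem_lineHits_iff_intercept (K : Set E3) (α β c q s : ℝ) :
    (vec3 0 q (c + α * q), s, α * s + β) ∈ lineHits K ↔ √(1 + α ^ 2) * q ∈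
      lineIntercepts (planeSection K α β c)
        ((1 + α ^ 2) / √(1 + α ^ 2 + β ^ 2) * s + α * β / √(1 + α ^ 2 + β ^ 2)) := by
  have hj : 0 < √(1 + α ^ 2) := by positivity
  have hD : 0 < √(1 + α ^ 2 + β ^ 2) := by positivity
  have hj2 : 1 + α ^ 2 = √(1 + α ^ 2) ^ 2 := (Real.sq_sqrt (by positivity)).symm
  simp only [lineHits, lineIntercepts, Set.mem_ofPred_eq, Set.mem_image, smul_vec3, vec3_add]
  constructor
  · rintro ⟨τ, h⟩
    refine ⟨planeCoord α β (vec3 (0 + τ * 1) (q + τ * s) (c + α * q + τ * (α * s + β))), ?_, ?_⟩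
    · simp only [planeSection, Set.mem_preimage]
      rw [planePoint_planeCoord]
      · exact h
      · simp only [vec3_zero, vec3_one, vec3_two]; ring
    · simp only [planeCoord, vec3_zero, vec3_one]
      generalize √(1 + α ^ 2 + β ^ 2) = D at *
      generalize √(1 + α ^ 2) = j at *
      rw [hj2]
      field_simp
      ring
  · rintro ⟨p, hp, h⟩
    refine ⟨(planePoint α β c p) 0, ?_⟩
    have h1 : (planePoint α β c p) 1 = q + s * (planePoint α β c p) 0 := by
      simp only [planePoint, vec3_zero, vec3_one]
      generalize √(1 + α ^ 2 + β ^ 2) = D at *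
      generalize √(1 + α ^ 2) = j at *
      rw [hj2] at h
      have : q = (p.2 - (j ^ 2 / D * s + α * β / D) * p.1) / j := by
        rw [h]; field_simp
      rw [this]
      field_simp
      ring
    have h2 := planePoint_mem_plane α β c p
    convert (show planePoint α β c p ∈ K from hp) using 1
    rw [← vec3_eta (planePoint α β c p), h2, h1]
    simp only [vec3_zero]
    congr 1 <;> ring

lemma chartWeight_ne_top (v : ℝ) : chartWeight v ≠ ⊤ := ENNReal.ofReal_ne_top

lemma chartWeight_mul {a v : ℝ} (ha : 0 ≤ a) :
    chartWeight (a ^ 2 * v) = ENNReal.ofReal (a⁻¹ ^ 3) * chartWeight v := by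
  rw [chartWeight, chartWeight, ← ENNReal.ofReal_mul (by positivity),
    Real.sqrt_mul (by positivity), Real.sqrt_sq ha]
  congr 1; rw [mul_inv, mul_pow]

/-- With j² = 1 + α² and D² = 1 + α² + β², the weight contributes (j/D)³, the intercept 1/j and the
slope D/j², with product 1/D². -/
lemma planeWidth_eq {K : Set E3} (hK : IsCompact K) (α β c : ℝ) :
    planeWidth K (α, β, c) =
      ENNReal.ofReal (1 + α ^ 2 + β ^ 2)⁻¹ * linesMeasure (planeSection K α β c) := by
  set S := planeSection K α β c
  have hj : 0 < √(1 + α ^ 2) := by positivity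
  have hD : 0 < √(1 + α ^ 2 + β ^ 2) := by positivity
  have hj2 : 1 + α ^ 2 = √(1 + α ^ 2) ^ 2 := (Real.sq_sqrt (by positivity)).symm
  have hD2 : 1 + α ^ 2 + β ^ 2 = √(1 + α ^ 2 + β ^ 2) ^ 2 := (Real.sq_sqrt (by positivity)).symm
  have hslope : ∀ s, slopeWidth K α β c s =
      ENNReal.ofReal ((1 + α ^ 2) / √(1 + α ^ 2 + β ^ 2) ^ 3) *
        (chartWeight (1 + ((1 + α ^ 2) / √(1 + α ^ 2 + β ^ 2) * s +
          α * β / √(1 + α ^ 2 + β ^ 2)) ^ 2) * volume (lineIntercepts S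
        ((1 + α ^ 2) / √(1 + α ^ 2 + β ^ 2) * s + α * β / √(1 + α ^ 2 + β ^ 2)))) := by
    intro s
    set σ := (1 + α ^ 2) / √(1 + α ^ 2 + β ^ 2) * s + α * β / √(1 + α ^ 2 + β ^ 2) with hσ
    -- In orthonormal coordinates the direction (1, s, αs + β) is (D/j)(1, σ).
    have hv : 1 + s ^ 2 + (α * s + β) ^ 2 =
        (√(1 + α ^ 2 + β ^ 2) / √(1 + α ^ 2)) ^ 2 * (1 + σ ^ 2) := by
      have : (√(1 + α ^ 2 + β ^ 2) / √(1 + α ^ 2)) ^ 2 * (1 + σ ^ 2) =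
          (√(1 + α ^ 2 + β ^ 2) ^ 2 + ((1 + α ^ 2) * s + α * β) ^ 2) / √(1 + α ^ 2) ^ 2 := by
        rw [hσ]; field_simp
      rw [this, ← hj2, ← hD2]
      field_simp
      ring
    have hind : ∀ q, hitInd K (vec3 0 q (c + α * q), s, α * s + β) =
        (lineIntercepts S σ).indicator 1 (√(1 + α ^ 2) * q) := by
      intro q
      classical
      simp only [hitInd, Set.indicator_apply, mem_lineHits_iff_intercept, Pi.one_apply]
      rfl
    rw [slopeWidth, hv, chartWeight_mul (by positivity),
      lintegral_const_mul' _ _ (ENNReal.mul_ne_top ENNReal.ofReal_ne_top (chartWeight_ne_top _))]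
    have hvol : volume (lineIntercepts S σ) = ENNReal.ofReal (√(1 + α ^ 2)) *
        ∫⁻ q, (lineIntercepts S σ).indicator 1 (√(1 + α ^ 2) * q) := by
      rw [← lintegral_indicator_one
        (isCompact_lineIntercepts (isCompact_planeSection hK α β c) σ).measurableSet,
        lintegral_eq_abs_mul_lintegral_comp_mul hj.ne', abs_of_pos hj]
    rw [lintegral_congr hind, hvol, mul_left_comm (chartWeight _), ← mul_assoc, ← mul_assoc,
      ← ENNReal.ofReal_mul (by positivity)]
    congr 3
    generalize √(1 + α ^ 2 + β ^ 2) = D at *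
    rw [hj2, Real.sqrt_sq hj.le]
    generalize √(1 + α ^ 2) = j at *
    field_simp
  have hk : 0 < (1 + α ^ 2) / √(1 + α ^ 2 + β ^ 2) := by positivity
  simp only [planeWidth]
  rw [lintegral_congr hslope, lintegral_const_mul' _ _ ENNReal.ofReal_ne_top, linesMeasure,
    lintegral_eq_abs_mul_lintegral_affine hk.ne' (α * β / √(1 + α ^ 2 + β ^ 2))
      (fun σ => chartWeight (1 + σ ^ 2) * volume (lineIntercepts S σ)), ← mul_assoc,
    ← ENNReal.ofReal_mul (by positivity), abs_of_pos hk]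
  congr 2
  rw [show (1 + α ^ 2 + β ^ 2)⁻¹ = (√(1 + α ^ 2 + β ^ 2) ^ 2)⁻¹ by rw [← hD2]]
  generalize √(1 + α ^ 2 + β ^ 2) = D at *
  field_simp

/-! ### Section areas and the volume -/

/-- The area of the projection to the `xy`-plane of the section of `K` by `z = c + β x + α y`. -/
noncomputable def sectionArea (K : Set E3) (p : ℝ × ℝ × ℝ) : ENNReal :=
  ∫⁻ x : ℝ, ∫⁻ y : ℝ, K.indicator 1 (vec3 x y (p.2.2 + p.2.1 * x + p.1 * y))

lemma sectionArea_eq {K : Set E3} (hK : IsCompact K) (α β c : ℝ) :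
    sectionArea K (α, β, c) =
      ENNReal.ofReal (√(1 + α ^ 2 + β ^ 2))⁻¹ * volume (planeSection K α β c) := by
  have hj : 0 < √(1 + α ^ 2) := by positivity
  have hD : 0 < √(1 + α ^ 2 + β ^ 2) := by positivity
  have hm : MeasurableSet (planeSection K α β c) := (isCompact_planeSection hK α β c).measurableSet
  rw [← lintegral_indicator_one hm, Measure.volume_eq_prod,
    lintegral_prod _ (measurable_one.indicator hm).aemeasurable]
  simp only [sectionArea]
  have hk : 0 < √(1 + α ^ 2) / √(1 + α ^ 2 + β ^ 2) := by positivity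
  have hl : 0 < 1 / √(1 + α ^ 2) := by positivity
  rw [lintegral_eq_abs_mul_lintegral_comp_mul hk.ne']
  rw [lintegral_congr fun a => lintegral_eq_abs_mul_lintegral_affine hl.ne'
    (-(α * β / (√(1 + α ^ 2) * √(1 + α ^ 2 + β ^ 2)) * a)) _]
  rw [lintegral_const_mul' _ _ ENNReal.ofReal_ne_top, ← mul_assoc,
    ← ENNReal.ofReal_mul (by positivity), abs_of_pos hk, abs_of_pos hl]
  congr 2
  field_simp

lemma measurable_sectionArea {K : Set E3} (hK : IsCompact K) : Measurable (sectionArea K) := by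
  refine Measurable.lintegral_prod_right' (f := fun r : (ℝ × ℝ × ℝ) × ℝ => ∫⁻ y : ℝ,
    K.indicator 1 (vec3 r.2 y (r.1.2.2 + r.1.2.1 * r.2 + r.1.1 * y))) ?_
  refine Measurable.lintegral_prod_right' (f := fun r : ((ℝ × ℝ × ℝ) × ℝ) × ℝ =>
    K.indicator 1 (vec3 r.1.2 r.2 (r.1.1.2.2 + r.1.1.2.1 * r.1.2 + r.1.1.1 * r.2))) ?_
  exact (measurable_one.indicator hK.measurableSet).comp (by fun_prop)

/-- For fixed α and β the planes are parallel, and a shear preserves volume; projected areas thus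
need no density. -/
lemma lintegral_sectionArea {K : Set E3} (hK : IsCompact K) (α β : ℝ) :
    ∫⁻ c : ℝ, sectionArea K (α, β, c) = volume K := by
  have hm := measurable_one.indicator (f := (1 : E3 → ENNReal)) hK.measurableSet
  rw [← lintegral_indicator_one hK.measurableSet, lintegral_E3 hm]
  simp only [sectionArea]
  have hm3 : Measurable fun r : (ℝ × ℝ) × ℝ => K.indicator (1 : E3 → ENNReal)
      (vec3 r.1.2 r.2 (r.1.1 + β * r.1.2 + α * r.2)) := hm.comp (by fun_prop)
  rw [lintegral_lintegral_swap hm3.lintegral_prod_right'.aemeasurable]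
  refine lintegral_congr fun x => ?_
  rw [lintegral_lintegral_swap (f := fun c y => K.indicator (1 : E3 → ENNReal)
    (vec3 x y (c + β * x + α * y))) (hm.comp (by fun_prop)).aemeasurable]
  refine lintegral_congr fun y => ?_
  simp_rw [add_assoc]
  exact lintegral_add_right_eq_self (fun z => K.indicator (1 : E3 → ENNReal) (vec3 x y z)) _

/-- Each plane direction contributes the whole volume, and the directions have total weight 2π, the
area of a half sphere of normals. -/
lemma lintegral_chartWeight_mul_sectionArea {K : Set E3} (hK : IsCompact K) :
    ∫⁻ p : ℝ × ℝ × ℝ, chartWeight (1 + p.1 ^ 2 + p.2.1 ^ 2) * sectionArea K p =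
      ENNReal.ofReal (2 * Real.pi) * volume K := by
  have hm : Measurable fun p : ℝ × ℝ × ℝ =>
      chartWeight (1 + p.1 ^ 2 + p.2.1 ^ 2) * sectionArea K p :=
    Measurable.mul (by fun_prop) (measurable_sectionArea hK)
  rw [Measure.volume_eq_prod, lintegral_prod _ hm.aemeasurable, ← lintegral_chartWeight]
  have hfin : volume K ≠ ⊤ := hK.measure_lt_top.ne
  rw [← lintegral_mul_const' _ _ hfin]
  refine lintegral_congr fun α => ?_
  rw [← lintegral_mul_const' _ _ hfin, Measure.volume_eq_prod,
    lintegral_prod (fun y : ℝ × ℝ => chartWeight (1 + α ^ 2 + y.1 ^ 2) * sectionArea K (α, y))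
      (hm.comp (measurable_prodMk_left (x := α))).aemeasurable]
  refine lintegral_congr fun β => ?_
  rw [← lintegral_sectionArea hK α β, ← lintegral_const_mul' _ _ (chartWeight_ne_top _)]

/-! ### Fourier analysis of the area of circumscribed polygons -/

/-- The Fourier coefficients of a real function on `[0, 2π]`. -/
noncomputable def circleCoeff (u : ℝ → ℝ) (k : ℤ) : ℂ :=
  (1 / (2 * Real.pi) : ℝ) • ∫ x in (0 : ℝ)..2 * Real.pi, Complex.exp (-(k * x * Complex.I)) * u x

lemma hasSum_circleCoeff {u : ℝ → ℝ} (hu : Continuous u) :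
    HasSum (fun k => ‖circleCoeff u k‖ ^ 2)
      ((2 * Real.pi)⁻¹ * ∫ x in (0 : ℝ)..2 * Real.pi, u x ^ 2) := by
  have hc : Continuous fun x => (u x : ℂ) := by fun_prop
  have hL2 : MemLp (fun x => (u x : ℂ)) 2 (volume.restrict (Set.Ioc 0 (2 * Real.pi))) := by
    obtain ⟨C, hC⟩ := (isCompact_Icc (a := (0 : ℝ)) (b := 2 * Real.pi)).exists_bound_of_continuousOn
      hc.continuousOn
    refine MemLp.of_bound hc.aestronglyMeasurable C ?_
    filter_upwards [ae_restrict_mem measurableSet_Ioc] with x hx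
    exact hC x (Set.Ioc_subset_Icc_self hx)
  have h := hasSum_sq_fourierCoeffOn Real.two_pi_pos hL2
  convert h using 1
  · ext k
    rw [fourierCoeffOn_eq_integral, circleCoeff, sub_zero]
    congr 3
    refine intervalIntegral.integral_congr fun x _ => ?_
    simp only [fourier_coe_apply, smul_eq_mul]
    congr 2
    push_cast
    have : (Real.pi : ℂ) ≠ 0 := by exact_mod_cast Real.pi_ne_zero
    field_simp
  · simp

lemma circleCoeff_zero (u : ℝ → ℝ) :
    circleCoeff u 0 = ((2 * Real.pi)⁻¹ * ∫ x in (0 : ℝ)..2 * Real.pi, u x : ℝ) := by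
  simp only [circleCoeff, Int.cast_zero, zero_mul, neg_zero, Complex.exp_zero, one_mul]
  rw [intervalIntegral.integral_ofReal]
  simp

lemma circleCoeff_add {u v : ℝ → ℝ} (hu : Continuous u) (hv : Continuous v) (k : ℤ) :
    circleCoeff (fun x => u x + v x) k = circleCoeff u k + circleCoeff v k := by
  simp only [circleCoeff]
  rw [← smul_add, ← intervalIntegral.integral_add]
  · simp only [Complex.ofReal_add, mul_add]
  · exact Continuous.intervalIntegrable (by fun_prop) _ _
  · exact Continuous.intervalIntegrable (by fun_prop) _ _

lemma circleCoeff_const_mul (a : ℝ) (u : ℝ → ℝ) (k : ℤ) :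
    circleCoeff (fun x => a * u x) k = a * circleCoeff u k := by
  simp only [circleCoeff, Complex.real_smul]
  rw [mul_left_comm]
  congr 1
  rw [← intervalIntegral.integral_const_mul]
  congr 1
  funext x
  push_cast; ring

lemma circleCoeff_shift {u : ℝ → ℝ} (hp : Function.Periodic u (2 * Real.pi)) (δ : ℝ) (k : ℤ) :
    circleCoeff (fun x => u (x + δ)) k = Complex.exp (k * δ * Complex.I) * circleCoeff u k := by
  simp only [circleCoeff, Complex.real_smul]
  rw [mul_left_comm]
  congr 1
  rw [← intervalIntegral.integral_const_mul]
  set F : ℝ → ℂ := fun x => Complex.exp (k * δ * Complex.I) *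
    (Complex.exp (-(k * x * Complex.I)) * u x) with hF
  have hper : Function.Periodic F (2 * Real.pi) := by
    intro x
    simp only [hF, hp x]
    congr 2
    rw [← Complex.exp_periodic.int_mul (-k) (-(k * x * Complex.I))]
    congr 1; push_cast; ring
  have h1 : ∀ x : ℝ, Complex.exp (-(k * x * Complex.I)) * u (x + δ) = F (x + δ) := by
    intro x
    simp only [hF]
    rw [← mul_assoc, ← Complex.exp_add]
    congr 2; push_cast; ring
  simp_rw [h1]
  rw [intervalIntegral.integral_comp_add_right, zero_add, add_comm (2 * Real.pi),
    hper.intervalIntegral_add_eq δ 0, zero_add]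

/-- A shift by π/k multiplies the k-th coefficient by -1 but fixes a constant function. -/
lemma circleCoeff_const {k : ℤ} (hk : k ≠ 0) (a : ℝ) : circleCoeff (fun _ => a) k = 0 := by
  have h := circleCoeff_shift (u := fun _ => a) (fun _ => rfl) (Real.pi / k) k
  have e : Complex.exp (k * (Real.pi / k : ℝ) * Complex.I) = -1 := by
    have : (k : ℂ) ≠ 0 := by exact_mod_cast hk
    push_cast
    rw [mul_div_cancel₀ _ this, Complex.exp_pi_mul_I]
  rw [e] at h
  simp only at h
  have h2 : (2 : ℂ) * circleCoeff (fun _ => a) k = 0 := by linear_combination h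
  simpa using h2

lemma norm_exp_sub_one_sq (θ : ℝ) : ‖Complex.exp (θ * Complex.I) - 1‖ ^ 2 = 2 - 2 * Real.cos θ := by
  rw [← Complex.normSq_eq_norm_sq, Complex.normSq_apply]
  simp only [Complex.sub_re, Complex.exp_ofReal_mul_I_re, Complex.one_re, Complex.sub_im,
    Complex.exp_ofReal_mul_I_im, Complex.one_im]
  nlinarith [Real.sin_sq_add_cos_sq θ]

/-- The support function polarization in terms of Fourier coefficients. -/
lemma hasSum_polygon_form {h : ℝ → ℝ} (hc : Continuous h) (hp : Function.Periodic h (2 * Real.pi))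
    (δ : ℝ) :
    HasSum (fun k : ℤ => ‖circleCoeff h k‖ ^ 2 * (2 * Real.cos (k * δ) - 2 * Real.cos δ))
      ((2 * Real.pi)⁻¹ * ∫ x in (0 : ℝ)..2 * Real.pi,
        h x * (h (x + δ) + h (x - δ) - 2 * Real.cos δ * h x)) := by
  have hper2 : ∫ x in (0 : ℝ)..2 * Real.pi, h (x + δ) ^ 2 =
      ∫ x in (0 : ℝ)..2 * Real.pi, h x ^ 2 := by
    have hq : Function.Periodic (fun x => h x ^ 2) (2 * Real.pi) := fun x => by simp only [hp x]
    rw [intervalIntegral.integral_comp_add_right (fun x => h x ^ 2), zero_add,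
      add_comm (2 * Real.pi), hq.intervalIntegral_add_eq δ 0, zero_add]
  have hcross : ∫ x in (0 : ℝ)..2 * Real.pi, h x * h (x - δ) =
      ∫ x in (0 : ℝ)..2 * Real.pi, h x * h (x + δ) := by
    have hq : Function.Periodic (fun x => h x * h (x - δ)) (2 * Real.pi) := fun x => by
      simp only [hp x]
      rw [show x + 2 * Real.pi - δ = x - δ + 2 * Real.pi by ring, hp]
    have := intervalIntegral.integral_comp_add_right (a := 0) (b := 2 * Real.pi)
      (fun x => h x * h (x - δ)) δ
    rw [zero_add, add_comm (2 * Real.pi), hq.intervalIntegral_add_eq δ 0, zero_add] at this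
    rw [← this]
    refine intervalIntegral.integral_congr fun x _ => ?_
    simp only [add_sub_cancel_right]; ring
  have h1 := hasSum_circleCoeff hc
  have h2 := hasSum_circleCoeff (u := fun x => h (x + δ) + (-1) * h x) (by fun_prop)
  have h3 := (h1.mul_left (2 - 2 * Real.cos δ)).sub h2
  -- The cross term is polarized through the difference h(x + δ) - h(x), whose multiplier has
  -- squared norm |e^{ikδ} - 1|² = 2 - 2cos kδ; only Parseval for squares is then needed.
  have hf : ∀ k : ℤ, ‖circleCoeff h k‖ ^ 2 * (2 * Real.cos (k * δ) - 2 * Real.cos δ) =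
      (2 - 2 * Real.cos δ) * ‖circleCoeff h k‖ ^ 2 -
        ‖circleCoeff (fun x => h (x + δ) + (-1) * h x) k‖ ^ 2 := by
    intro k
    rw [circleCoeff_add (u := fun x => h (x + δ)) (v := fun x => (-1) * h x) (by fun_prop)
      (by fun_prop), circleCoeff_shift hp, circleCoeff_const_mul]
    have e : Complex.exp (k * δ * Complex.I) * circleCoeff h k + ((-1 : ℝ) : ℂ) * circleCoeff h k =
        (Complex.exp ((k * δ : ℝ) * Complex.I) - 1) * circleCoeff h k := by push_cast; ring
    rw [e, norm_mul, mul_pow, norm_exp_sub_one_sq]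
    ring
  have ha : (2 * Real.pi)⁻¹ * ∫ x in (0 : ℝ)..2 * Real.pi,
        h x * (h (x + δ) + h (x - δ) - 2 * Real.cos δ * h x) =
      (2 - 2 * Real.cos δ) * ((2 * Real.pi)⁻¹ * ∫ x in (0 : ℝ)..2 * Real.pi, h x ^ 2) -
        (2 * Real.pi)⁻¹ * ∫ x in (0 : ℝ)..2 * Real.pi, (h (x + δ) + (-1) * h x) ^ 2 := by
    have hsq : IntervalIntegrable (fun x => h x ^ 2) volume 0 (2 * Real.pi) :=
      Continuous.intervalIntegrable (by fun_prop) _ _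
    have hsq2 : IntervalIntegrable (fun x => h (x + δ) ^ 2) volume 0 (2 * Real.pi) :=
      Continuous.intervalIntegrable (by fun_prop) _ _
    have hx1 : IntervalIntegrable (fun x => h x * h (x + δ)) volume 0 (2 * Real.pi) :=
      Continuous.intervalIntegrable (by fun_prop) _ _
    have hx2 : IntervalIntegrable (fun x => h x * h (x - δ)) volume 0 (2 * Real.pi) :=
      Continuous.intervalIntegrable (by fun_prop) _ _
    have e1 : ∫ x in (0 : ℝ)..2 * Real.pi, h x * (h (x + δ) + h (x - δ) - 2 * Real.cos δ * h x) =
        2 * (∫ x in (0 : ℝ)..2 * Real.pi, h x * h (x + δ)) -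
          2 * Real.cos δ * ∫ x in (0 : ℝ)..2 * Real.pi, h x ^ 2 := by
      rw [two_mul (∫ x in (0 : ℝ)..2 * Real.pi, h x * h (x + δ)),
        ← intervalIntegral.integral_const_mul]
      nth_rewrite 2 [← hcross]
      rw [← intervalIntegral.integral_add hx1 hx2,
        ← intervalIntegral.integral_sub (hx1.add hx2) (hsq.const_mul _)]
      refine intervalIntegral.integral_congr fun x _ => ?_
      ring
    have e2 : ∫ x in (0 : ℝ)..2 * Real.pi, (h (x + δ) + (-1) * h x) ^ 2 =
        2 * (∫ x in (0 : ℝ)..2 * Real.pi, h x ^ 2) -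
          2 * ∫ x in (0 : ℝ)..2 * Real.pi, h x * h (x + δ) := by
      rw [two_mul (∫ x in (0 : ℝ)..2 * Real.pi, h x ^ 2)]
      nth_rewrite 1 [← hper2]
      rw [← intervalIntegral.integral_const_mul, ← intervalIntegral.integral_add hsq2 hsq,
        ← intervalIntegral.integral_sub (hsq2.add hsq) (hx1.const_mul _)]
      refine intervalIntegral.integral_congr fun x _ => ?_
      ring
    rw [e1, e2]; ring
  rw [funext hf, ha]
  exact h3

/-- The weight of the `k`-th Fourier mode in the area of a circumscribed equiangular `4m`-gon. -/
noncomputable def polygonWeight (m : ℕ) (k : ℤ) : ℝ :=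
  4 * m * (Real.cos (k * (2 * Real.pi / (4 * m))) - Real.cos (2 * Real.pi / (4 * m))) /
    Real.sin (2 * Real.pi / (4 * m))

lemma tendsto_sin_mul_div (a : ℝ) : Tendsto (fun x : ℝ => Real.sin (a * x) / x) (𝓝[≠] 0) (𝓝 a) := by
  have h : HasDerivAt (fun x : ℝ => Real.sin (a * x)) a 0 := by
    have := (Real.hasDerivAt_sin (a * 0)).comp 0 ((hasDerivAt_id (0 : ℝ)).const_mul a)
    simpa [Function.comp_def] using this
  have := hasDerivAt_iff_tendsto_slope.1 h
  refine this.congr fun x => ?_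
  simp [slope_def_field]

/-- With δ = 2π/4m, the weight is (2π/δ)(cos kδ - cos δ)/sin δ, and cos kδ - cos δ ~ (1 - k²)δ²/2.
-/
lemma tendsto_polygonWeight (k : ℤ) :
    Tendsto (fun m => polygonWeight m k) atTop (𝓝 (Real.pi * (1 - (k : ℝ) ^ 2))) := by
  have hδ : Tendsto (fun m : ℕ => 2 * Real.pi / (4 * m)) atTop (𝓝[≠] 0) := by
    refine tendsto_nhdsWithin_iff.2 ⟨?_, ?_⟩
    · exact tendsto_const_nhds.div_atTop
        (tendsto_natCast_atTop_atTop.const_mul_atTop (by norm_num))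
    · filter_upwards [eventually_ge_atTop 1] with m hm
      have : (0 : ℝ) < m := by exact_mod_cast hm
      have := Real.pi_pos
      exact (by positivity : 2 * Real.pi / (4 * (m : ℝ)) ≠ 0)
  have h1 := tendsto_sin_mul_div (((k : ℝ) + 1) / 2)
  have h2 := tendsto_sin_mul_div (((k : ℝ) - 1) / 2)
  have h3 := (tendsto_sin_mul_div 1).inv₀ one_ne_zero
  have h4 := (((h1.mul h2).mul h3).const_mul (-4 * Real.pi)).comp hδ
  have e : -4 * Real.pi * (((k : ℝ) + 1) / 2 * (((k : ℝ) - 1) / 2) * 1⁻¹) =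
      Real.pi * (1 - (k : ℝ) ^ 2) := by ring
  rw [e] at h4
  refine h4.congr' ?_
  filter_upwards [eventually_ge_atTop 1] with m hm
  have hm0 : (0 : ℝ) < m := by exact_mod_cast hm
  have hpi := Real.pi_pos
  simp only [Function.comp, polygonWeight]
  set δ := 2 * Real.pi / (4 * (m : ℝ)) with hδ
  have hδ0 : 0 < δ := by positivity
  have hmδ : 4 * (m : ℝ) = 2 * Real.pi / δ := by rw [hδ]; field_simp
  have hcos : Real.cos (k * δ) - Real.cos δ =
      -2 * Real.sin (((k : ℝ) + 1) / 2 * δ) * Real.sin (((k : ℝ) - 1) / 2 * δ) := by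
    rw [Real.cos_sub_cos]; congr 3 <;> ring
  rw [hcos, hmδ, one_mul, inv_div]
  field_simp
  ring

lemma polygonWeight_le {m : ℕ} (hm : 1 ≤ m) (k : ℤ) : polygonWeight m k ≤ polygonWeight m 0 := by
  have hm0 : (1 : ℝ) ≤ m := by exact_mod_cast hm
  have hpi := Real.pi_pos
  have hs : 0 ≤ Real.sin (2 * Real.pi / (4 * m)) := by
    refine Real.sin_nonneg_of_nonneg_of_le_pi (by positivity) ?_
    rw [div_le_iff₀ (by positivity)]; nlinarith
  unfold polygonWeight
  gcongr
  simpa using Real.cos_le_one _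

/-- Once |k|δ ≤ π, monotonicity of the cosine on [0, π] gives cos kδ ≤ cos δ. -/
lemma eventually_polygonWeight_nonpos {k : ℤ} (hk : k ≠ 0) :
    ∀ᶠ m in atTop, polygonWeight m k ≤ 0 := by
  filter_upwards [eventually_ge_atTop (k.natAbs + 1)] with m hm
  have hpi := Real.pi_pos
  have hkm : |(k : ℝ)| + 1 ≤ m := by
    have : ((k.natAbs + 1 : ℕ) : ℝ) ≤ m := by exact_mod_cast hm
    push_cast at this
    rwa [Nat.cast_natAbs, Int.cast_abs] at this
  have hk1 : (1 : ℝ) ≤ |(k : ℝ)| := by exact_mod_cast Int.one_le_abs hk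
  have hm0 : (0 : ℝ) < m := by linarith
  have hs : 0 ≤ Real.sin (2 * Real.pi / (4 * m)) := by
    refine Real.sin_nonneg_of_nonneg_of_le_pi (by positivity) ?_
    rw [div_le_iff₀ (by positivity)]; nlinarith
  unfold polygonWeight
  refine div_nonpos_of_nonpos_of_nonneg (mul_nonpos_of_nonneg_of_nonpos (by positivity) ?_) hs
  rw [sub_nonpos, ← Real.cos_abs (k * _), abs_mul,
    abs_of_nonneg (by positivity : 0 ≤ 2 * Real.pi / (4 * (m : ℝ)))]
  refine Real.cos_le_cos_of_nonneg_of_le_pi (by positivity) ?_ ?_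
  · rw [← mul_div_assoc, div_le_iff₀ (by positivity)]; nlinarith
  · exact le_mul_of_one_le_left (by positivity) hk1

/-- Passage to the limit in the area bounds given by circumscribed equiangular polygons. -/
lemma le_of_le_polygon_sum {c : ℤ → ℝ} (hc0 : ∀ k, 0 ≤ c k) (hc : Summable c) {A : ℝ}
    (hA : ∀ m : ℕ, 1 ≤ m → ∃ B, HasSum (fun k => c k * polygonWeight m k) B ∧ A ≤ B)
    {k₀ : ℤ} (hk₀ : k₀ ≠ 0) : A ≤ Real.pi * c 0 - Real.pi * ((k₀ : ℝ) ^ 2 - 1) * c k₀ := by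
  -- The limiting weights π(1 - k²) are unbounded below, so the sums cannot be dominated as they
  -- stand. Replacing negative weights by 0, except at k₀, keeps the upper bound and makes dominated
  -- convergence available.
  set g : ℕ → ℤ → ℝ := fun m k => if k = k₀ then polygonWeight m k else max (polygonWeight m k) 0
    with hg
  set l : ℤ → ℝ := fun k => if k = k₀ then Real.pi * (1 - (k : ℝ) ^ 2) else
    if k = 0 then Real.pi else 0 with hl
  have hlim : ∀ k, Tendsto (fun m => g m k) atTop (𝓝 (l k)) := by
    intro k
    simp only [hg, hl]
    split_ifs with h1 h2
    · exact tendsto_polygonWeight k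
    · have := (tendsto_polygonWeight k).max (tendsto_const_nhds (x := (0 : ℝ)))
      rw [h2] at this ⊢
      convert this using 2
      simp [Real.pi_pos.le]
    · refine tendsto_const_nhds.congr' ?_
      filter_upwards [eventually_polygonWeight_nonpos h2] with m hm
      exact (max_eq_right hm).symm
  -- The limit at k = 0 is π; any constant above it would serve.
  have hb0 : ∀ᶠ m in atTop, polygonWeight m 0 ≤ 4 := by
    have := tendsto_polygonWeight 0
    refine (this.eventually (eventually_le_nhds (b := 4) ?_))
    simpa using Real.pi_lt_four
  obtain ⟨C, hC⟩ := (tendsto_polygonWeight k₀).norm.isBoundedUnder_le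
  rw [eventually_map] at hC
  have hbound : ∀ᶠ m in atTop, ∀ k, ‖c k * g m k‖ ≤ c k * max 4 C := by
    filter_upwards [hb0, hC, eventually_ge_atTop 1] with m h0 h1 hm k
    rw [norm_mul, Real.norm_of_nonneg (hc0 k)]
    refine mul_le_mul_of_nonneg_left ?_ (hc0 k)
    simp only [hg]
    split_ifs with h
    · rw [h]; exact h1.trans (le_max_right _ _)
    · rw [Real.norm_of_nonneg (le_max_right _ _)]
      refine (max_le ?_ (by norm_num)).trans (le_max_left _ _)
      exact (polygonWeight_le hm k).trans h0
  have ht := tendsto_tsum_of_dominated_convergence (hc.mul_right (max 4 C))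
    (fun k => (hlim k).const_mul (c k)) hbound
  have hl0 : ∑' k, c k * l k = Real.pi * c 0 - Real.pi * ((k₀ : ℝ) ^ 2 - 1) * c k₀ := by
    rw [tsum_eq_sum (s := {0, k₀})]
    · rw [Finset.sum_pair (Ne.symm hk₀)]
      simp only [hl, if_neg (Ne.symm hk₀), if_true]
      ring
    · intro k hk
      simp only [Finset.mem_insert, Finset.mem_singleton, not_or] at hk
      simp [hl, hk.1, hk.2]
  rw [← hl0]
  refine ge_of_tendsto ht ?_
  filter_upwards [hbound, eventually_ge_atTop 1] with m hm hm1
  obtain ⟨B, hB, hAB⟩ := hA m hm1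
  refine hAB.trans ?_
  have hs : Summable fun k => c k * g m k := Summable.of_norm_bounded (hc.mul_right _) hm
  refine hasSum_le (fun k => mul_le_mul_of_nonneg_left ?_ (hc0 k)) hB hs.hasSum
  simp only [hg]
  split_ifs with h
  · exact le_rfl
  · exact le_max_left _ _

/-- The area of the equiangular `4m`-gon with support numbers `h (φ + i δ)`, `δ = 2π / 4m`. -/
noncomputable def polygonArea (h : ℝ → ℝ) (m : ℕ) (φ : ℝ) : ℝ :=
  ∑ i ∈ Finset.range (4 * m), h (φ + i * (2 * Real.pi / (4 * m))) *
    (h (φ + i * (2 * Real.pi / (4 * m)) + 2 * Real.pi / (4 * m)) +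
      h (φ + i * (2 * Real.pi / (4 * m)) - 2 * Real.pi / (4 * m)) -
      2 * Real.cos (2 * Real.pi / (4 * m)) * h (φ + i * (2 * Real.pi / (4 * m)))) /
    (2 * Real.sin (2 * Real.pi / (4 * m)))

lemma integral_polygonArea {h : ℝ → ℝ} (hc : Continuous h)
    (hp : Function.Periodic h (2 * Real.pi)) (m : ℕ) :
    ∫ φ in (0 : ℝ)..2 * Real.pi, polygonArea h m φ =
      4 * m / (2 * Real.sin (2 * Real.pi / (4 * m))) * ∫ x in (0 : ℝ)..2 * Real.pi,
        h x * (h (x + 2 * Real.pi / (4 * m)) + h (x - 2 * Real.pi / (4 * m)) -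
          2 * Real.cos (2 * Real.pi / (4 * m)) * h x) := by
  unfold polygonArea
  set δ := 2 * Real.pi / (4 * m)
  rw [intervalIntegral.integral_finsetSum]
  swap
  · intro i _
    exact Continuous.intervalIntegrable (by fun_prop) _ _
  set G : ℝ → ℝ := fun x => h x * (h (x + δ) + h (x - δ) - 2 * Real.cos δ * h x) with hG
  have hGp : Function.Periodic G (2 * Real.pi) := by
    intro x
    simp only [hG]
    rw [hp x, show x + 2 * Real.pi + δ = x + δ + 2 * Real.pi by ring, hp,
      show x + 2 * Real.pi - δ = x - δ + 2 * Real.pi by ring, hp]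
  have e : ∀ i ∈ Finset.range (4 * m), (∫ φ in (0 : ℝ)..2 * Real.pi, h (φ + i * δ) *
      (h (φ + i * δ + δ) + h (φ + i * δ - δ) - 2 * Real.cos δ * h (φ + i * δ)) /
        (2 * Real.sin δ)) = (∫ x in (0 : ℝ)..2 * Real.pi, G x) / (2 * Real.sin δ) := by
    intro i _
    rw [intervalIntegral.integral_div]
    congr 1
    have := intervalIntegral.integral_comp_add_right (a := 0) (b := 2 * Real.pi) G (i * δ)
    rw [zero_add, add_comm (2 * Real.pi), hGp.intervalIntegral_add_eq _ 0, zero_add] at this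
    exact this
  rw [Finset.sum_congr rfl e, Finset.sum_const, Finset.card_range, nsmul_eq_mul]
  push_cast
  ring

/-- Averaging the polygon area over all rotations φ diagonalizes it in the Fourier basis;
`le_of_le_polygon_sum` then takes the limit. -/
lemma le_of_le_polygonArea {h : ℝ → ℝ} (hc : Continuous h) (hp : Function.Periodic h (2 * Real.pi))
    {A : ℝ} (hA : ∀ m : ℕ, 1 ≤ m → ∀ φ, A ≤ polygonArea h m φ) {k : ℤ} (hk : k ≠ 0) :
    A ≤ Real.pi * ‖circleCoeff h 0‖ ^ 2 -
      Real.pi * ((k : ℝ) ^ 2 - 1) * ‖circleCoeff h k‖ ^ 2 := by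
  refine le_of_le_polygon_sum (fun k => sq_nonneg _) (hasSum_circleCoeff hc).summable ?_ hk
  intro m hm
  refine ⟨4 * m / (2 * Real.sin (2 * Real.pi / (4 * m))) * ((2 * Real.pi)⁻¹ *
    ∫ x in (0 : ℝ)..2 * Real.pi, h x * (h (x + 2 * Real.pi / (4 * m)) +
      h (x - 2 * Real.pi / (4 * m)) - 2 * Real.cos (2 * Real.pi / (4 * m)) * h x)), ?_, ?_⟩
  · have h1 := (hasSum_polygon_form hc hp (2 * Real.pi / (4 * m))).mul_left
      (4 * m / (2 * Real.sin (2 * Real.pi / (4 * m))))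
    have e : ∀ k : ℤ, ‖circleCoeff h k‖ ^ 2 * polygonWeight m k =
        4 * m / (2 * Real.sin (2 * Real.pi / (4 * m))) * (‖circleCoeff h k‖ ^ 2 *
          (2 * Real.cos (k * (2 * Real.pi / (4 * m))) - 2 * Real.cos (2 * Real.pi / (4 * m)))) := by
      intro k
      rw [polygonWeight]
      ring
    rw [funext e]
    exact h1
  · have h2 : ∫ _ in (0 : ℝ)..2 * Real.pi, A ≤ ∫ φ in (0 : ℝ)..2 * Real.pi, polygonArea h m φ := by
      refine intervalIntegral.integral_mono_on Real.two_pi_pos.le (by simp) ?_ fun φ _ => hA m hm φ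
      refine Continuous.intervalIntegrable ?_ _ _
      unfold polygonArea
      fun_prop
    rw [intervalIntegral.integral_const, sub_zero, smul_eq_mul, integral_polygonArea hc hp] at h2
    rw [mul_left_comm]
    rwa [inv_mul_eq_div, le_div_iff₀' Real.two_pi_pos]

lemma pi_mul_norm_circleCoeff_zero (h : ℝ → ℝ) :
    Real.pi * ‖circleCoeff h 0‖ ^ 2 = (∫ x in (0 : ℝ)..2 * Real.pi, h x) ^ 2 / (4 * Real.pi) := by
  rw [circleCoeff_zero, Complex.norm_real, Real.norm_eq_abs, sq_abs]
  have := Real.pi_pos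
  field_simp
  ring

/-- This is the mode k = 1, where the correction term vanishes. -/
lemma isoperimetric_of_le_polygonArea {h : ℝ → ℝ} (hc : Continuous h)
    (hp : Function.Periodic h (2 * Real.pi)) {A : ℝ}
    (hA : ∀ m : ℕ, 1 ≤ m → ∀ φ, A ≤ polygonArea h m φ) :
    4 * Real.pi * A ≤ (∫ x in (0 : ℝ)..2 * Real.pi, h x) ^ 2 := by
  have h1 := le_of_le_polygonArea hc hp hA one_ne_zero
  rw [pi_mul_norm_circleCoeff_zero, Int.cast_one] at h1
  have := Real.pi_pos
  rw [← le_div_iff₀' (by positivity)]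
  linarith

lemma eq_zero_of_circleCoeff_eq_zero {w : ℝ → ℝ} (hc : Continuous w)
    (hp : Function.Periodic w (2 * Real.pi)) (h0 : ∀ k, circleCoeff w k = 0) (x : ℝ) : w x = 0 := by
  have h3 := hasSum_circleCoeff hc
  simp only [h0, norm_zero, ne_eq, OfNat.ofNat_ne_zero, not_false_eq_true, zero_pow] at h3
  have h1 := h3.unique hasSum_zero
  have h2 : ∫ x in x..x + 2 * Real.pi, w x ^ 2 = 0 := by
    have hq : Function.Periodic (fun x => w x ^ 2) (2 * Real.pi) := fun x => by simp only [hp x]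
    rw [hq.intervalIntegral_add_eq x 0, zero_add]
    simpa [Real.pi_ne_zero] using h1
  by_contra hx
  have hpos : 0 < ∫ y in x..x + 2 * Real.pi, w y ^ 2 := by
    refine intervalIntegral.integral_pos (by linarith [Real.pi_pos]) (by fun_prop)
      (fun y _ => sq_nonneg _) ⟨x, ?_, by positivity⟩
    exact ⟨le_rfl, by linarith [Real.pi_pos]⟩
  exact hpos.ne' h2

/-- Equality kills every mode with |k| ≥ 2, since there k² - 1 > 0. The remaining modes are
recognized by a functional equation instead of by summing the Fourier series. -/
lemma eq_trig_of_isoperimetric_eq {h : ℝ → ℝ} (hc : Continuous h)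
    (hp : Function.Periodic h (2 * Real.pi)) {A : ℝ}
    (hA : ∀ m : ℕ, 1 ≤ m → ∀ φ, A ≤ polygonArea h m φ)
    (heq : (∫ x in (0 : ℝ)..2 * Real.pi, h x) ^ 2 ≤ 4 * Real.pi * A) :
    ∃ a b c : ℝ, ∀ x, h x = a + b * Real.cos x + c * Real.sin x := by
  have hpi := Real.pi_pos
  have hk : ∀ k : ℤ, k ≠ 0 → k ≠ 1 → k ≠ -1 → circleCoeff h k = 0 := by
    intro k h0 h1 h2
    have h3 := le_of_le_polygonArea hc hp hA h0
    rw [pi_mul_norm_circleCoeff_zero] at h3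
    have h4 : (∫ x in (0 : ℝ)..2 * Real.pi, h x) ^ 2 / (4 * Real.pi) ≤ A := by
      rw [div_le_iff₀' (by positivity)]; exact heq
    have h5 : (4 : ℝ) ≤ (k : ℝ) ^ 2 := by
      have : (4 : ℤ) ≤ k ^ 2 := by
        rcases (by omega : 2 ≤ k ∨ k ≤ -2) with h | h <;> nlinarith
      exact_mod_cast this
    have h6 : Real.pi * 3 * ‖circleCoeff h k‖ ^ 2 ≤ 0 := by
      have : 0 ≤ Real.pi * ((k : ℝ) ^ 2 - 4) * ‖circleCoeff h k‖ ^ 2 :=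
        mul_nonneg (mul_nonneg hpi.le (by linarith)) (sq_nonneg _)
      nlinarith
    have h7 : ‖circleCoeff h k‖ ^ 2 ≤ 0 := by
      by_contra hcon
      push Not at hcon
      have : 0 < Real.pi * 3 * ‖circleCoeff h k‖ ^ 2 := by positivity
      linarith
    exact norm_eq_zero.1 (pow_eq_zero_iff two_ne_zero |>.1 (le_antisymm h7 (sq_nonneg _)))
  set a : ℝ := (2 * Real.pi)⁻¹ * ∫ x in (0 : ℝ)..2 * Real.pi, h x with ha
  -- Subtracting the mean a from h should leave f with f(x + δ) + f(x - δ) = 2 cos δ f(x). All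
  -- Fourier coefficients of the defect vanish: the modes ±1 by Euler's formula, the mode 0 by the
  -- choice of a.
  have hw : ∀ δ x, h (x + δ) + (h (x + -δ) + ((-2 * Real.cos δ) * h x +
      (2 * Real.cos δ - 2) * a)) = 0 := by
    intro δ
    refine eq_zero_of_circleCoeff_eq_zero (by fun_prop) ?_ ?_
    · intro x
      simp only
      rw [hp x, show x + 2 * Real.pi + δ = x + δ + 2 * Real.pi by ring, hp,
        show x + 2 * Real.pi + -δ = x + -δ + 2 * Real.pi by ring, hp]
    · intro k
      rw [circleCoeff_add (u := fun x => h (x + δ)) (by fun_prop) (by fun_prop),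
        circleCoeff_add (u := fun x => h (x + -δ)) (by fun_prop) (by fun_prop),
        circleCoeff_add (u := fun x => (-2 * Real.cos δ) * h x) (by fun_prop) (by fun_prop),
        circleCoeff_shift hp, circleCoeff_shift hp, circleCoeff_const_mul]
      have hcos : Complex.exp (δ * Complex.I) + Complex.exp (-(δ * Complex.I)) =
          2 * Complex.cos δ := by rw [Complex.cos]; ring_nf
      by_cases h0 : k = 0
      · subst h0
        rw [circleCoeff_zero, circleCoeff_zero, ← ha, intervalIntegral.integral_const]
        simp only [Int.cast_zero, zero_mul, Complex.exp_zero, one_mul, sub_zero, smul_eq_mul]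
        push_cast
        have : (Real.pi : ℂ) ≠ 0 := by exact_mod_cast Real.pi_ne_zero
        field_simp
        ring
      · rw [circleCoeff_const h0]
        by_cases h1 : k = 1
        · subst h1
          push_cast
          linear_combination (circleCoeff h 1) * (by simpa [neg_mul] using hcos :
            Complex.exp (1 * δ * Complex.I) + Complex.exp (1 * -δ * Complex.I) =
              2 * Complex.cos δ)
        · by_cases h2 : k = -1
          · subst h2
            push_cast
            linear_combination (circleCoeff h (-1)) * (by simpa [neg_mul, add_comm] using hcos :
              Complex.exp (-1 * δ * Complex.I) + Complex.exp (-1 * -δ * Complex.I) =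
                2 * Complex.cos δ)
          · rw [hk k h0 h1 h2]; simp
  refine ⟨a, h 0 - a, h (Real.pi / 2) - a, fun x => ?_⟩
  -- The values at -x and π - x introduced by the first two instances cancel in w1 + w2 - w3,
  -- leaving 2h(x).
  have w1 := hw x 0
  have w2 := hw (x - Real.pi / 2) (Real.pi / 2)
  have w3 := hw (Real.pi / 2) (-x + Real.pi / 2)
  rw [Real.cos_sub_pi_div_two] at w2
  rw [Real.cos_pi_div_two] at w3
  rw [zero_add, zero_add] at w1
  rw [show Real.pi / 2 + (x - Real.pi / 2) = x by ring,
    show Real.pi / 2 + -(x - Real.pi / 2) = -x + Real.pi / 2 + Real.pi / 2 by ring] at w2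
  rw [show -x + Real.pi / 2 + -(Real.pi / 2) = -x by ring] at w3
  linarith

/-! ### Support functions and circumscribed equiangular polygons -/

/-- The support function of a plane set in the direction with polar angle `φ`. -/
noncomputable def supportFn (S : Set (ℝ × ℝ)) (φ : ℝ) : ℝ :=
  sSup ((fun p : ℝ × ℝ => p.1 * Real.cos φ + p.2 * Real.sin φ) '' S)

lemma continuous_supportFn {S : Set (ℝ × ℝ)} (hS : IsCompact S) : Continuous (supportFn S) := by
  refine hS.continuous_sSup (f := fun φ (p : ℝ × ℝ) => p.1 * Real.cos φ + p.2 * Real.sin φ) ?_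
  show Continuous fun q : ℝ × ℝ × ℝ => q.2.1 * Real.cos q.1 + q.2.2 * Real.sin q.1
  fun_prop

lemma periodic_supportFn (S : Set (ℝ × ℝ)) : Function.Periodic (supportFn S) (2 * Real.pi) := by
  intro φ
  simp [supportFn]

lemma le_supportFn {S : Set (ℝ × ℝ)} (hS : IsCompact S) {p : ℝ × ℝ} (hp : p ∈ S) (φ : ℝ) :
    p.1 * Real.cos φ + p.2 * Real.sin φ ≤ supportFn S φ :=
  le_csSup (hS.image (by fun_prop)).bddAbove ⟨p, hp, rfl⟩

lemma exists_eq_supportFn {S : Set (ℝ × ℝ)} (hS : IsCompact S) (hne : S.Nonempty) (φ : ℝ) :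
    ∃ p ∈ S, p.1 * Real.cos φ + p.2 * Real.sin φ = supportFn S φ := by
  obtain ⟨p, hp, h⟩ := hS.exists_sSup_image_eq hne
    (f := fun p : ℝ × ℝ => p.1 * Real.cos φ + p.2 * Real.sin φ) (by fun_prop)
  exact ⟨p, hp, h.symm⟩

/-- The triangle with apex `z`, base on the line at distance `H` from `z` with normal angle `θ`,
and with base endpoints at signed distances `-a` and `b` from the foot of the normal. -/
def apexTriangle (z : ℝ × ℝ) (θ H a b : ℝ) : Set (ℝ × ℝ) :=
  {x | 0 ≤ (x.1 - z.1) * Real.cos θ + (x.2 - z.2) * Real.sin θ ∧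
    (x.1 - z.1) * Real.cos θ + (x.2 - z.2) * Real.sin θ ≤ H ∧
    -a * (((x.1 - z.1) * Real.cos θ + (x.2 - z.2) * Real.sin θ) / H) ≤
      -(x.1 - z.1) * Real.sin θ + (x.2 - z.2) * Real.cos θ ∧
    -(x.1 - z.1) * Real.sin θ + (x.2 - z.2) * Real.cos θ ≤
      b * (((x.1 - z.1) * Real.cos θ + (x.2 - z.2) * Real.sin θ) / H)}

lemma volume_apexTriangle (z : ℝ × ℝ) (θ : ℝ) {H a b : ℝ} (hH : 0 < H) (hab : 0 ≤ a + b) :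
    volume (apexTriangle z θ H a b) = ENNReal.ofReal (H * (a + b) / 2) := by
  set T : Set (ℝ × ℝ) := {x | 0 ≤ x.1 ∧ x.1 ≤ H ∧ -a * (x.1 / H) ≤ x.2 ∧ x.2 ≤ b * (x.1 / H)}
    with hT
  set f : ℝ × ℝ →ₗ[ℝ] ℝ × ℝ := Matrix.toLin (Module.Basis.finTwoProd ℝ) (Module.Basis.finTwoProd ℝ)
    !![Real.cos θ, Real.sin θ; -Real.sin θ, Real.cos θ] with hf
  have hdet : LinearMap.det f = 1 := by
    rw [hf, LinearMap.det_toLin, Matrix.det_fin_two_of]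
    nlinarith [Real.sin_sq_add_cos_sq θ]
  have e : apexTriangle z θ H a b = (fun x => x + -z) ⁻¹' (f ⁻¹' T) := by
    ext x
    simp only [apexTriangle, hT, Set.mem_preimage, Set.mem_ofPred_eq, hf,
      Matrix.toLin_finTwoProd_apply, Prod.fst_sub, Prod.snd_sub,
      ← sub_eq_add_neg, mul_comm (Real.cos θ), mul_comm (Real.sin θ), mul_comm (-Real.sin θ),
      neg_mul_comm]
  rw [e, measure_preimage_add_right, Measure.addHaar_preimage_linearMap _ (by rw [hdet]; simp),
    hdet]
  simp only [inv_one, abs_one, ENNReal.ofReal_one, one_mul]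
  have hTm : MeasurableSet T := by
    have h1 : MeasurableSet {x : ℝ × ℝ | 0 ≤ x.1} := measurableSet_le (by fun_prop) (by fun_prop)
    have h2 : MeasurableSet {x : ℝ × ℝ | x.1 ≤ H} := measurableSet_le (by fun_prop) (by fun_prop)
    have h3 : MeasurableSet {x : ℝ × ℝ | -a * (x.1 / H) ≤ x.2} :=
      measurableSet_le (by fun_prop) (by fun_prop)
    have h4 : MeasurableSet {x : ℝ × ℝ | x.2 ≤ b * (x.1 / H)} :=
      measurableSet_le (by fun_prop) (by fun_prop)
    exact h1.inter (h2.inter (h3.inter h4))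
  rw [Measure.volume_eq_prod, Measure.prod_apply hTm]
  have hslice : ∀ x : ℝ, volume (Prod.mk x ⁻¹' T) =
      (Set.Icc 0 H).indicator (fun x => ENNReal.ofReal ((a + b) / H * x)) x := by
    intro x
    by_cases hx : x ∈ Set.Icc 0 H
    · rw [Set.indicator_of_mem hx]
      have : Prod.mk x ⁻¹' T = Set.Icc (-a * (x / H)) (b * (x / H)) := by
        ext y; simp [hT, hx.1, hx.2]
      rw [this, Real.volume_Icc]
      congr 1; ring
    · rw [Set.indicator_of_notMem hx]
      have : Prod.mk x ⁻¹' T = ∅ := by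
        ext y
        simp only [Set.mem_preimage, hT, Set.mem_ofPred_eq, Set.mem_empty_iff_false, iff_false]
        exact fun h => hx ⟨h.1, h.2.1⟩
      rw [this, measure_empty]
  rw [lintegral_congr hslice, lintegral_indicator measurableSet_Icc,
    ← ofReal_integral_eq_lintegral_ofReal]
  · rw [integral_Icc_eq_integral_Ioc, ← intervalIntegral.integral_of_le hH.le,
      intervalIntegral.integral_const_mul, integral_id]
    congr 1
    field_simp
    ring
  · exact Continuous.integrableOn_Icc (by fun_prop)
  · filter_upwards [ae_restrict_mem measurableSet_Icc] with x hx
    have := hx.1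
    simp only [Pi.zero_apply]
    positivity

lemma exists_max_of_periodic {f : ℤ → ℝ} {n : ℕ} (hn : 0 < n) (hf : Function.Periodic f n) :
    ∃ i ∈ Finset.range n, ∀ j : ℤ, f j ≤ f (i : ℤ) := by
  obtain ⟨i, hi, h⟩ := Finset.exists_max_image (Finset.range n) (fun i : ℕ => f i)
    ⟨0, Finset.mem_range.2 hn⟩
  refine ⟨i, hi, fun j => ?_⟩
  have hn' : (0 : ℤ) < n := by exact_mod_cast hn
  have h1 : 0 ≤ j % n := Int.emod_nonneg _ hn'.ne'
  have h2 : j % n < n := Int.emod_lt_of_pos _ hn'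
  have h3 : f j = f ((j % n).toNat : ℕ) := by
    rw [Int.toNat_of_nonneg h1, Int.emod_def]
    have := hf.sub_zsmul_eq (x := j) (j / n)
    rw [← this]
    congr 1
    simp [mul_comm]
  rw [h3]
  exact h _ (Finset.mem_range.2 (by omega))

/-- Support function relative to the base point `z`. -/
noncomputable def supportFrom (S : Set (ℝ × ℝ)) (z : ℝ × ℝ) (φ : ℝ) : ℝ :=
  supportFn S φ - (z.1 * Real.cos φ + z.2 * Real.sin φ)

lemma le_supportFrom {S : Set (ℝ × ℝ)} (hS : IsCompact S) (z : ℝ × ℝ) {p : ℝ × ℝ} (hp : p ∈ S)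
    (φ : ℝ) : (p.1 - z.1) * Real.cos φ + (p.2 - z.2) * Real.sin φ ≤ supportFrom S z φ := by
  have := le_supportFn hS hp φ
  rw [supportFrom]
  linarith

lemma supportFrom_pos {S : Set (ℝ × ℝ)} (hS : IsCompact S) {z : ℝ × ℝ} (hz : z ∈ interior S)
    (φ : ℝ) : 0 < supportFrom S z φ := by
  have hc : Continuous fun ε : ℝ => (z.1 + ε * Real.cos φ, z.2 + ε * Real.sin φ) := by fun_prop
  have hmem : ∀ᶠ ε in 𝓝[>] (0 : ℝ), (z.1 + ε * Real.cos φ, z.2 + ε * Real.sin φ) ∈ S := by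
    refine nhdsWithin_le_nhds ?_
    refine hc.continuousAt.eventually_mem ?_
    simpa using mem_interior_iff_mem_nhds.1 hz
  obtain ⟨ε, h1, h2⟩ := (hmem.and self_mem_nhdsWithin).exists
  have h3 := le_supportFrom hS z h1 φ
  have h4 : (0 : ℝ) < ε := h2
  simp only [add_sub_cancel_left] at h3
  nlinarith [Real.sin_sq_add_cos_sq φ]

/-- A point attaining the support in direction φ is tested in the directions φ ± δ. Up to the factor
sin δ the difference of the two sides is the side length of the circumscribed polygon, which is thus
nonnegative. -/
lemma supportFrom_add_add_sub {S : Set (ℝ × ℝ)} (hS : IsCompact S) (hne : S.Nonempty) (z : ℝ × ℝ)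
    (φ δ : ℝ) : 2 * Real.cos δ * supportFrom S z φ ≤
      supportFrom S z (φ + δ) + supportFrom S z (φ - δ) := by
  obtain ⟨p, hp, h⟩ := exists_eq_supportFn hS hne φ
  have h1 := le_supportFrom hS z hp (φ + δ)
  have h2 := le_supportFrom hS z hp (φ - δ)
  rw [supportFrom, ← h]
  rw [Real.cos_add, Real.sin_add] at h1
  rw [Real.cos_sub, Real.sin_sub] at h2
  linarith

/-- The circumscribed polygon is cut from z into triangles over its sides. A point x lies in the
triangle over the side that maximizes the ratio of the height of x - z along the normal to the
support number; maximality against the two neighbouring sides gives the lateral bounds. -/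
lemma subset_iUnion_apexTriangle {S : Set (ℝ × ℝ)} (hS : IsCompact S) {z : ℝ × ℝ}
    (hz : z ∈ interior S) {m : ℕ} (hm : 1 ≤ m) (φ : ℝ) :
    S ⊆ ⋃ i ∈ Finset.range (4 * m), apexTriangle z (φ + i * (2 * Real.pi / (4 * m)))
      (supportFrom S z (φ + i * (2 * Real.pi / (4 * m))))
      ((supportFrom S z (φ + i * (2 * Real.pi / (4 * m)) - 2 * Real.pi / (4 * m)) -
        supportFrom S z (φ + i * (2 * Real.pi / (4 * m))) * Real.cos (2 * Real.pi / (4 * m))) /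
          Real.sin (2 * Real.pi / (4 * m)))
      ((supportFrom S z (φ + i * (2 * Real.pi / (4 * m)) + 2 * Real.pi / (4 * m)) -
        supportFrom S z (φ + i * (2 * Real.pi / (4 * m))) * Real.cos (2 * Real.pi / (4 * m))) /
          Real.sin (2 * Real.pi / (4 * m))) := by
  intro x hx
  have hm0 : (1 : ℝ) ≤ m := by exact_mod_cast hm
  have hpi := Real.pi_pos
  set δ := 2 * Real.pi / (4 * (m : ℝ)) with hδ
  have hmδ : m * δ = Real.pi / 2 := by rw [hδ]; field_simp; ring
  have hδ0 : 0 < δ := by positivity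
  have hδpi : δ < Real.pi := by nlinarith
  have hsin : 0 < Real.sin δ := Real.sin_pos_of_pos_of_lt_pi hδ0 hδpi
  have hHp : Function.Periodic (supportFrom S z) (2 * Real.pi) := fun θ => by
    simp [supportFrom, periodic_supportFn S θ]
  set L : ℝ → ℝ := fun θ => (x.1 - z.1) * Real.cos θ + (x.2 - z.2) * Real.sin θ with hL
  have hLp : Function.Periodic L (2 * Real.pi) := fun θ => by simp [hL]
  have hH : ∀ θ, 0 < supportFrom S z θ := supportFrom_pos hS hz
  set f : ℤ → ℝ := fun i => L (φ + i * δ) / supportFrom S z (φ + i * δ) with hf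
  have hfp : Function.Periodic f ((4 * m : ℕ) : ℤ) := by
    intro i
    have e : φ + ((i + ((4 * m : ℕ) : ℤ) : ℤ) : ℝ) * δ = φ + i * δ + 2 * Real.pi := by
      push_cast; linear_combination 4 * hmδ
    simp only [hf]
    rw [e, hLp, hHp]
  obtain ⟨i, hi, hmax⟩ := exists_max_of_periodic (by omega : 0 < 4 * m) hfp
  refine Set.mem_biUnion hi ?_
  set θ := φ + i * δ with hθ
  have hmax' : ∀ j : ℤ, L (φ + j * δ) ≤ f i * supportFrom S z (φ + j * δ) := fun j => by
    have := hmax j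
    simp only [hf] at this ⊢
    rwa [div_le_iff₀ (hH _)] at this
  have hfi : f i * supportFrom S z θ = L θ := by
    simp only [hf, Int.cast_natCast]
    exact div_mul_cancel₀ _ (hH _).ne'
  have hfi0 : 0 ≤ f i := by
    -- The number of sides is even, so the normals numbered 0 and 2m are opposite, and x - z cannot
    -- have negative height along both.
    by_contra hneg
    push Not at hneg
    have hLneg : ∀ j : ℤ, L (φ + j * δ) < 0 := fun j =>
      (hmax' j).trans_lt (mul_neg_of_neg_of_pos hneg (hH _))
    have h1 := hLneg 0
    have h2 := hLneg (2 * m)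
    rw [show φ + ((2 * m : ℤ) : ℝ) * δ = φ + ((0 : ℤ) : ℝ) * δ + Real.pi by
      push_cast; linear_combination 2 * hmδ] at h2
    simp only [hL, Real.cos_add_pi, Real.sin_add_pi] at h1 h2
    linarith
  have hLθ : L θ / supportFrom S z θ = f i := by
    simp only [hf, Int.cast_natCast]; rfl
  have hplus := hmax' (i + 1)
  have hminus := hmax' (i - 1)
  rw [show φ + ((i + 1 : ℤ) : ℝ) * δ = θ + δ by push_cast; rw [hθ]; ring] at hplus
  rw [show φ + ((i - 1 : ℤ) : ℝ) * δ = θ - δ by push_cast; rw [hθ]; ring] at hminus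
  have hp2 : L (θ + δ) = L θ * Real.cos δ +
      (-(x.1 - z.1) * Real.sin θ + (x.2 - z.2) * Real.cos θ) * Real.sin δ := by
    simp only [hL, Real.cos_add, Real.sin_add]; ring
  have hm2 : L (θ - δ) = L θ * Real.cos δ -
      (-(x.1 - z.1) * Real.sin θ + (x.2 - z.2) * Real.cos θ) * Real.sin δ := by
    simp only [hL, Real.cos_sub, Real.sin_sub]; ring
  refine ⟨?_, le_supportFrom hS z hx θ, ?_, ?_⟩
  · change 0 ≤ L θ
    rw [← hfi]
    exact mul_nonneg hfi0 (hH θ).le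
  · change -_ * (L θ / _) ≤ _
    rw [hLθ, ← neg_div, div_mul_eq_mul_div, div_le_iff₀ hsin]
    rw [hm2, ← hfi] at hminus
    linarith
  · change _ ≤ _ * (L θ / _)
    rw [hLθ, div_mul_eq_mul_div, le_div_iff₀ hsin]
    rw [hp2, ← hfi] at hplus
    linarith

lemma volume_le_polygonArea {S : Set (ℝ × ℝ)} (hS : IsCompact S) {z : ℝ × ℝ}
    (hz : z ∈ interior S) {m : ℕ} (hm : 1 ≤ m) (φ : ℝ) :
    (volume S).toReal ≤ polygonArea (supportFrom S z) m φ := by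
  have hm0 : (1 : ℝ) ≤ m := by exact_mod_cast hm
  have hpi := Real.pi_pos
  have hne : S.Nonempty := ⟨z, interior_subset hz⟩
  have h1 := subset_iUnion_apexTriangle hS hz hm φ
  rw [polygonArea]
  set δ := 2 * Real.pi / (4 * (m : ℝ)) with hδ
  have hmδ : m * δ = Real.pi / 2 := by rw [hδ]; field_simp; ring
  have hδ0 : 0 < δ := by positivity
  have hδpi : δ < Real.pi := by nlinarith
  have hsin : 0 < Real.sin δ := Real.sin_pos_of_pos_of_lt_pi hδ0 hδpi
  have hnonneg : ∀ θ, 0 ≤ supportFrom S z θ * (supportFrom S z (θ + δ) + supportFrom S z (θ - δ) -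
      2 * Real.cos δ * supportFrom S z θ) / (2 * Real.sin δ) := by
    intro θ
    have := supportFrom_add_add_sub hS hne z θ δ
    have := supportFrom_pos hS hz θ
    exact div_nonneg (mul_nonneg this.le (by linarith)) (by positivity)
  refine ENNReal.toReal_le_of_le_ofReal (Finset.sum_nonneg fun i _ => hnonneg _) ?_
  rw [ENNReal.ofReal_sum_of_nonneg fun i _ => hnonneg _]
  refine (measure_mono h1).trans ((measure_biUnion_finset_le _ _).trans ?_)
  refine Finset.sum_le_sum fun i _ => ?_
  set θ := φ + i * δ
  have hc := supportFrom_add_add_sub hS hne z θ δ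
  rw [volume_apexTriangle _ _ (supportFrom_pos hS hz θ)]
  · refine ENNReal.ofReal_le_ofReal (le_of_eq ?_)
    field_simp
    ring
  · rw [← add_div]
    exact div_nonneg (by linarith) hsin.le

/-! ### Cauchy's perimeter formula and the isoperimetric inequality -/

lemma supportFn_of_isMax {S : Set (ℝ × ℝ)} {φ v : ℝ} {q : ℝ × ℝ} (hq : q ∈ S)
    (h : q.1 * Real.cos φ + q.2 * Real.sin φ = v)
    (hle : ∀ p ∈ S, p.1 * Real.cos φ + p.2 * Real.sin φ ≤ v) : supportFn S φ = v := by
  refine IsGreatest.csSup_eq ⟨⟨q, hq, h⟩, ?_⟩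
  rintro _ ⟨p, hp, rfl⟩
  exact hle p hp

lemma supportFn_add_pi_nonneg {S : Set (ℝ × ℝ)} (hS : IsCompact S) (hne : S.Nonempty) (ψ : ℝ) :
    0 ≤ supportFn S (ψ + Real.pi / 2) + supportFn S (ψ - Real.pi / 2) := by
  obtain ⟨p, hp⟩ := hne
  have h1 := le_supportFn hS hp (ψ + Real.pi / 2)
  have h2 := le_supportFn hS hp (ψ - Real.pi / 2)
  rw [Real.cos_add_pi_div_two, Real.sin_add_pi_div_two] at h1
  rw [Real.cos_sub_pi_div_two, Real.sin_sub_pi_div_two] at h2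
  linarith

/-- By convexity the intercepts fill an interval. Its length is the width of S normal to the
direction ψ, stretched by 1/cos ψ because intercepts are measured vertically. -/
lemma volume_lineIntercepts {S : Set (ℝ × ℝ)} (hS : IsCompact S) (hconv : Convex ℝ S)
    (hne : S.Nonempty) {ψ : ℝ} (hψ : 0 < Real.cos ψ) :
    volume (lineIntercepts S (Real.tan ψ)) = ENNReal.ofReal
      ((supportFn S (ψ + Real.pi / 2) + supportFn S (ψ - Real.pi / 2)) / Real.cos ψ) := by
  have hconn : IsConnected (lineIntercepts S (Real.tan ψ)) :=
    ⟨hne.image _, hconv.isPreconnected.image _ (by fun_prop)⟩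
  have hval : ∀ p : ℝ × ℝ, p.2 - Real.tan ψ * p.1 =
      (p.1 * Real.cos (ψ + Real.pi / 2) + p.2 * Real.sin (ψ + Real.pi / 2)) / Real.cos ψ := by
    intro p
    rw [Real.cos_add_pi_div_two, Real.sin_add_pi_div_two, Real.tan_eq_sin_div_cos]
    field_simp
    ring
  have hval' : ∀ p : ℝ × ℝ, p.2 - Real.tan ψ * p.1 =
      -((p.1 * Real.cos (ψ - Real.pi / 2) + p.2 * Real.sin (ψ - Real.pi / 2)) / Real.cos ψ) := by
    intro p
    rw [Real.cos_sub_pi_div_two, Real.sin_sub_pi_div_two, Real.tan_eq_sin_div_cos]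
    field_simp
    ring
  have hsup : sSup (lineIntercepts S (Real.tan ψ)) =
      supportFn S (ψ + Real.pi / 2) / Real.cos ψ := by
    obtain ⟨q, hq, h⟩ := exists_eq_supportFn hS hne (ψ + Real.pi / 2)
    refine IsGreatest.csSup_eq ⟨⟨q, hq, ?_⟩, ?_⟩
    · simp only [hval, h]
    · rintro _ ⟨p, hp, rfl⟩
      simp only [hval]
      gcongr
      exact le_supportFn hS hp _
  have hinf : sInf (lineIntercepts S (Real.tan ψ)) =
      -(supportFn S (ψ - Real.pi / 2) / Real.cos ψ) := by
    obtain ⟨q, hq, h⟩ := exists_eq_supportFn hS hne (ψ - Real.pi / 2)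
    refine IsLeast.csInf_eq ⟨⟨q, hq, ?_⟩, ?_⟩
    · simp only [hval', h]
    · rintro _ ⟨p, hp, rfl⟩
      simp only [hval']
      gcongr
      exact le_supportFn hS hp _
  rw [eq_Icc_of_connected_compact hconn (isCompact_lineIntercepts hS _), hsup, hinf,
    Real.volume_Icc]
  congr 1
  ring

lemma image_tan_Ioo : Real.tan '' Set.Ioo (-(Real.pi / 2)) (Real.pi / 2) = Set.univ :=
  Real.surjOn_tan.image_eq_of_mapsTo (Set.mapsTo_univ _ _)

/-- Under σ = tan ψ the weight is cos³ψ, the derivative 1/cos²ψ and the interval length width/cos ψ,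
so the integrand is the width itself. Its two support values sweep a half turn each, together the
full circle. -/
lemma linesMeasure_eq {S : Set (ℝ × ℝ)} (hS : IsCompact S) (hconv : Convex ℝ S)
    (hne : S.Nonempty) :
    linesMeasure S = ENNReal.ofReal (∫ φ in (0 : ℝ)..2 * Real.pi, supportFn S φ) := by
  have hpi := Real.pi_pos
  have hc := continuous_supportFn hS
  have hcos : ∀ ψ ∈ Set.Ioo (-(Real.pi / 2)) (Real.pi / 2), 0 < Real.cos ψ := fun ψ h =>
    Real.cos_pos_of_mem_Ioo h
  rw [linesMeasure, ← setLIntegral_univ, ← image_tan_Ioo,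
    lintegral_image_eq_lintegral_abs_deriv_mul measurableSet_Ioo
      (fun ψ h => (Real.hasDerivAt_tan (hcos ψ h).ne').hasDerivWithinAt) Real.injOn_tan]
  have e1 : ∫⁻ ψ in Set.Ioo (-(Real.pi / 2)) (Real.pi / 2), ENNReal.ofReal |1 / Real.cos ψ ^ 2| *
      (chartWeight (1 + Real.tan ψ ^ 2) * volume (lineIntercepts S (Real.tan ψ))) =
      ∫⁻ ψ in Set.Ioo (-(Real.pi / 2)) (Real.pi / 2), ENNReal.ofReal
        (supportFn S (ψ + Real.pi / 2) + supportFn S (ψ - Real.pi / 2)) := by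
    refine setLIntegral_congr_fun measurableSet_Ioo fun ψ h => ?_
    have h0 := hcos ψ h
    rw [volume_lineIntercepts hS hconv hne h0, chartWeight, Real.inv_sqrt_one_add_tan_sq h0,
      ← ENNReal.ofReal_mul (by positivity), ← ENNReal.ofReal_mul (by positivity),
      abs_of_pos (by positivity)]
    congr 1
    field_simp
  rw [e1, ← ofReal_integral_eq_lintegral_ofReal]
  · congr 1
    rw [← integral_Ioc_eq_integral_Ioo, ← intervalIntegral.integral_of_le (by linarith),
      intervalIntegral.integral_add (Continuous.intervalIntegrable (by fun_prop) _ _)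
        (Continuous.intervalIntegrable (by fun_prop) _ _),
      intervalIntegral.integral_comp_add_right, intervalIntegral.integral_comp_sub_right, add_comm]
    rw [show -(Real.pi / 2) - Real.pi / 2 = -Real.pi by ring, sub_self, neg_add_cancel, add_halves,
      intervalIntegral.integral_add_adjacent_intervals (hc.intervalIntegrable _ _)
        (hc.intervalIntegrable _ _)]
    have := (periodic_supportFn S).intervalIntegral_add_eq (-Real.pi) 0
    rw [zero_add] at this
    rw [← this]
    congr 1; ring
  · exact (Continuous.integrableOn_Icc (by fun_prop)).mono_set Set.Ioo_subset_Icc_self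
  · exact Eventually.of_forall fun ψ => supportFn_add_pi_nonneg hS hne ψ

lemma integral_trig (b c : ℝ) :
    ∫ φ in (0 : ℝ)..2 * Real.pi, (b * Real.cos φ + c * Real.sin φ) = 0 := by
  rw [intervalIntegral.integral_add (Continuous.intervalIntegrable (by fun_prop) _ _)
    (Continuous.intervalIntegrable (by fun_prop) _ _), intervalIntegral.integral_const_mul,
    intervalIntegral.integral_const_mul]
  simp

lemma integral_supportFn_nonneg {S : Set (ℝ × ℝ)} (hS : IsCompact S) (hne : S.Nonempty) :
    0 ≤ ∫ φ in (0 : ℝ)..2 * Real.pi, supportFn S φ := by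
  obtain ⟨p, hp⟩ := hne
  refine (integral_trig p.1 p.2).symm.le.trans ?_
  refine intervalIntegral.integral_mono_on Real.two_pi_pos.le
    (Continuous.intervalIntegrable (by fun_prop) _ _)
    ((continuous_supportFn hS).intervalIntegrable _ _) fun φ _ => le_supportFn hS hp φ

lemma integral_supportFrom {S : Set (ℝ × ℝ)} (hS : IsCompact S) (z : ℝ × ℝ) :
    ∫ φ in (0 : ℝ)..2 * Real.pi, supportFrom S z φ =
      ∫ φ in (0 : ℝ)..2 * Real.pi, supportFn S φ := by
  unfold supportFrom
  rw [intervalIntegral.integral_sub ((continuous_supportFn hS).intervalIntegrable _ _)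
    (Continuous.intervalIntegrable (by fun_prop) _ _), integral_trig, sub_zero]

lemma continuous_supportFrom {S : Set (ℝ × ℝ)} (hS : IsCompact S) (z : ℝ × ℝ) :
    Continuous (supportFrom S z) := by
  have := continuous_supportFn hS
  unfold supportFrom
  fun_prop

lemma periodic_supportFrom (S : Set (ℝ × ℝ)) (z : ℝ × ℝ) :
    Function.Periodic (supportFrom S z) (2 * Real.pi) := fun θ => by
  simp [supportFrom, periodic_supportFn S θ]

/-- The isoperimetric inequality in terms of the measure of the lines that meet a plane convex
set. -/
lemma four_pi_mul_volume_le_linesMeasure_sq {S : Set (ℝ × ℝ)} (hS : IsCompact S)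
    (hconv : Convex ℝ S) : ENNReal.ofReal (4 * Real.pi) * volume S ≤ linesMeasure S ^ 2 := by
  rcases (interior S).eq_empty_or_nonempty with h | ⟨z, hz⟩
  · have : volume S = 0 := by
      rw [← hS.isClosed.closure_eq, closure_eq_interior_union_frontier, h, Set.empty_union]
      exact hconv.addHaar_frontier _
    simp [this]
  · have hne : S.Nonempty := ⟨z, interior_subset hz⟩
    have h1 := isoperimetric_of_le_polygonArea (continuous_supportFrom hS z)
      (periodic_supportFrom S z) fun m hm φ => volume_le_polygonArea hS hz hm φ
    rw [integral_supportFrom hS] at h1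
    rw [linesMeasure_eq hS hconv hne, ← ENNReal.ofReal_pow (integral_supportFn_nonneg hS hne),
      ← ENNReal.ofReal_toReal hS.measure_lt_top.ne, ← ENNReal.ofReal_mul (by positivity)]
    exact ENNReal.ofReal_le_ofReal h1

lemma exists_polar (x y : ℝ) : ∃ φ, x = √(x ^ 2 + y ^ 2) * Real.cos φ ∧
    y = √(x ^ 2 + y ^ 2) * Real.sin φ := by
  have h : ‖(⟨x, y⟩ : ℂ)‖ = √(x ^ 2 + y ^ 2) := by
    rw [Complex.norm_eq_sqrt_sq_add_sq]
  refine ⟨Complex.arg ⟨x, y⟩, ?_, ?_⟩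
  · rw [← h, Complex.norm_mul_cos_arg]
  · rw [← h, Complex.norm_mul_sin_arg]

lemma mul_cos_add_mul_sin_le (x y φ : ℝ) :
    x * Real.cos φ + y * Real.sin φ ≤ √(x ^ 2 + y ^ 2) := by
  refine Real.le_sqrt_of_sq_le ?_
  nlinarith [Real.sin_sq_add_cos_sq φ, sq_nonneg (x * Real.sin φ - y * Real.cos φ)]

/-- A compact convex set is determined by its support function: one inclusion tests the direction
from the centre to the point, the other separates a point outside S by Hahn–Banach. -/
lemma eq_disc_of_supportFn {S : Set (ℝ × ℝ)} (hS : IsCompact S) (hconv : Convex ℝ S)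
    (hne : S.Nonempty) {a b c : ℝ}
    (h : ∀ φ, supportFn S φ = a + b * Real.cos φ + c * Real.sin φ) :
    0 ≤ a ∧ S = {p | (p.1 - b) ^ 2 + (p.2 - c) ^ 2 ≤ a ^ 2} := by
  have hsub : ∀ p ∈ S, √((p.1 - b) ^ 2 + (p.2 - c) ^ 2) ≤ a := by
    intro p hp
    obtain ⟨φ, h1, h2⟩ := exists_polar (p.1 - b) (p.2 - c)
    have h3 := le_supportFn hS hp φ
    rw [h] at h3
    set ρ := √((p.1 - b) ^ 2 + (p.2 - c) ^ 2)
    have h4 : (p.1 - b) * Real.cos φ + (p.2 - c) * Real.sin φ = ρ := by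
      rw [h1, h2]; linear_combination ρ * Real.sin_sq_add_cos_sq φ
    linarith
  have ha : 0 ≤ a := by
    obtain ⟨p, hp⟩ := hne
    exact (Real.sqrt_nonneg _).trans (hsub p hp)
  refine ⟨ha, Set.Subset.antisymm (fun p hp => ?_) fun p hp => ?_⟩
  · exact (Real.sqrt_le_left ha).1 (hsub p hp)
  · by_contra hpS
    obtain ⟨f, u, hf1, hf2⟩ := geometric_hahn_banach_closed_point hconv hS.isClosed hpS
    obtain ⟨φ, h1, h2⟩ := exists_polar (f (1, 0)) (f (0, 1))
    set ρ := √(f (1, 0) ^ 2 + f (0, 1) ^ 2) with hρ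
    have hfe : ∀ q : ℝ × ℝ, f q = ρ * (q.1 * Real.cos φ + q.2 * Real.sin φ) := by
      intro q
      have : q = q.1 • ((1 : ℝ), (0 : ℝ)) + q.2 • ((0 : ℝ), (1 : ℝ)) := by ext <;> simp
      rw [this, map_add, map_smul, map_smul, h1, h2]
      simp
      ring
    obtain ⟨q, hq, hq2⟩ := exists_eq_supportFn hS hne φ
    have h3 := (hf1 q hq).trans hf2
    rw [hfe, hfe, hq2, h] at h3
    have h4 : p.1 * Real.cos φ + p.2 * Real.sin φ ≤ a + b * Real.cos φ + c * Real.sin φ := by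
      have h5 := mul_cos_add_mul_sin_le (p.1 - b) (p.2 - c) φ
      have h6 : √((p.1 - b) ^ 2 + (p.2 - c) ^ 2) ≤ a := (Real.sqrt_le_left ha).2 hp
      linarith
    exact absurd h3 (not_lt.2 (mul_le_mul_of_nonneg_left h4 (Real.sqrt_nonneg _)))

lemma exists_disc_of_linesMeasure_sq_le {S : Set (ℝ × ℝ)} (hS : IsCompact S) (hconv : Convex ℝ S)
    (hint : (interior S).Nonempty)
    (h : linesMeasure S ^ 2 ≤ ENNReal.ofReal (4 * Real.pi) * volume S) :
    ∃ (c : ℝ × ℝ) (r : ℝ), 0 ≤ r ∧ S = {p | (p.1 - c.1) ^ 2 + (p.2 - c.2) ^ 2 ≤ r ^ 2} := by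
  obtain ⟨z, hz⟩ := hint
  have hne : S.Nonempty := ⟨z, interior_subset hz⟩
  rw [linesMeasure_eq hS hconv hne, ← ENNReal.ofReal_pow (integral_supportFn_nonneg hS hne),
    ← ENNReal.ofReal_toReal hS.measure_lt_top.ne, ← ENNReal.ofReal_mul (by positivity),
    ENNReal.ofReal_le_ofReal_iff (by positivity), ← integral_supportFrom hS z] at h
  obtain ⟨a, b, c, hform⟩ := eq_trig_of_isoperimetric_eq (continuous_supportFrom hS z)
    (periodic_supportFrom S z) (fun m hm φ => volume_le_polygonArea hS hz hm φ) h
  obtain ⟨h1, h2⟩ := eq_disc_of_supportFn hS hconv hne (a := a) (b := b + z.1) (c := c + z.2)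
    fun φ => by
      have := hform φ
      rw [supportFrom] at this
      linarith
  exact ⟨(b + z.1, c + z.2), a, h1, h2⟩

lemma supportFn_disc (c : ℝ × ℝ) {r : ℝ} (hr : 0 ≤ r) (φ : ℝ) :
    supportFn {p | (p.1 - c.1) ^ 2 + (p.2 - c.2) ^ 2 ≤ r ^ 2} φ =
      r + (c.1 * Real.cos φ + c.2 * Real.sin φ) := by
  refine supportFn_of_isMax (q := (c.1 + r * Real.cos φ, c.2 + r * Real.sin φ)) ?_ ?_ ?_
  · simp only [Set.mem_ofPred_eq, add_sub_cancel_left]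
    nlinarith [Real.sin_sq_add_cos_sq φ]
  · nlinarith [Real.sin_sq_add_cos_sq φ]
  · intro p hp
    have h5 := mul_cos_add_mul_sin_le (p.1 - c.1) (p.2 - c.2) φ
    have h6 : √((p.1 - c.1) ^ 2 + (p.2 - c.2) ^ 2) ≤ r := (Real.sqrt_le_left hr).2 hp
    linarith

lemma volume_disc (c : ℝ × ℝ) {r : ℝ} (hr : 0 ≤ r) :
    volume {p : ℝ × ℝ | (p.1 - c.1) ^ 2 + (p.2 - c.2) ^ 2 ≤ r ^ 2} =
      ENNReal.ofReal (Real.pi * r ^ 2) := by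
  rw [← Complex.volume_preserving_equiv_real_prod.measure_preimage_equiv]
  have : Complex.measurableEquivRealProd ⁻¹'
      {p : ℝ × ℝ | (p.1 - c.1) ^ 2 + (p.2 - c.2) ^ 2 ≤ r ^ 2} =
      Metric.closedBall (⟨c.1, c.2⟩ : ℂ) r := by
    ext w
    simp only [Set.mem_preimage, Complex.measurableEquivRealProd_apply, Set.mem_ofPred_eq,
      Metric.mem_closedBall, Complex.dist_eq_re_im]
    exact (Real.sqrt_le_left hr).symm
  rw [this, Complex.volume_closedBall, ← ENNReal.ofReal_pow hr, mul_comm,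
    ENNReal.ofReal_mul Real.pi_pos.le]
  congr 1
  exact (ENNReal.ofReal_eq_coe_nnreal Real.pi_pos.le).symm

lemma linesMeasure_sq_disc {S : Set (ℝ × ℝ)} (hS : IsCompact S) (hconv : Convex ℝ S)
    {c : ℝ × ℝ} {r : ℝ} (hr : 0 ≤ r)
    (h : S = {p : ℝ × ℝ | (p.1 - c.1) ^ 2 + (p.2 - c.2) ^ 2 ≤ r ^ 2}) :
    linesMeasure S ^ 2 = ENNReal.ofReal (4 * Real.pi) * volume S := by
  have hne : S.Nonempty := ⟨c, by rw [h]; simp [sq_nonneg]⟩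
  have hpi := Real.pi_pos
  rw [linesMeasure_eq hS hconv hne]
  rw [h, volume_disc c hr]
  simp_rw [supportFn_disc c hr]
  rw [intervalIntegral.integral_add (by simp) (Continuous.intervalIntegrable (by fun_prop) _ _),
    integral_trig, intervalIntegral.integral_const, ← ENNReal.ofReal_pow (by simp; positivity),
    ← ENNReal.ofReal_mul (by positivity)]
  congr 1
  simp only [sub_zero, smul_eq_mul, add_zero]
  ring

lemma linesMeasure_le {S : Set (ℝ × ℝ)} (hS : IsCompact S) (hconv : Convex ℝ S) {c : ℝ × ℝ} {r : ℝ}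
    (hr : 0 ≤ r) (h : S ⊆ {p : ℝ × ℝ | (p.1 - c.1) ^ 2 + (p.2 - c.2) ^ 2 ≤ r ^ 2}) :
    linesMeasure S ≤ ENNReal.ofReal (2 * Real.pi * r) := by
  rcases S.eq_empty_or_nonempty with rfl | hne
  · simp [linesMeasure, lineIntercepts]
  rw [linesMeasure_eq hS hconv hne]
  refine ENNReal.ofReal_le_ofReal ?_
  have hle : ∀ φ, supportFn S φ ≤ r + (c.1 * Real.cos φ + c.2 * Real.sin φ) := by
    intro φ
    obtain ⟨p, hp, hpe⟩ := exists_eq_supportFn hS hne φ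
    have h5 := mul_cos_add_mul_sin_le (p.1 - c.1) (p.2 - c.2) φ
    have h6 : √((p.1 - c.1) ^ 2 + (p.2 - c.2) ^ 2) ≤ r := (Real.sqrt_le_left hr).2 (h hp)
    linarith
  have h1 : ∫ φ in (0 : ℝ)..2 * Real.pi, supportFn S φ ≤
      ∫ φ in (0 : ℝ)..2 * Real.pi, (r + (c.1 * Real.cos φ + c.2 * Real.sin φ)) :=
    intervalIntegral.integral_mono_on Real.two_pi_pos.le
      ((continuous_supportFn hS).intervalIntegrable _ _)
      (Continuous.intervalIntegrable (by fun_prop) _ _) fun φ _ => hle φ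
  rw [intervalIntegral.integral_add (by simp) (Continuous.intervalIntegrable (by fun_prop) _ _),
    integral_trig] at h1
  simpa using h1

/-! ### Integrability and the inequality -/

/-- With D² = 1 + α² + β², the weight D⁻³ and the projection factor D⁻¹ combine to D⁻⁴, the square
of the factor in `planeWidth_eq`. The isoperimetric inequality can thus be applied plane by plane.
-/
lemma chartWeight_mul_sectionArea {K : Set E3} (hK : IsCompact K) (α β c : ℝ) :
    ENNReal.ofReal (4 * Real.pi) *
        (chartWeight (1 + α ^ 2 + β ^ 2) * sectionArea K (α, β, c)) =
      ENNReal.ofReal (1 + α ^ 2 + β ^ 2)⁻¹ ^ 2 *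
        (ENNReal.ofReal (4 * Real.pi) * volume (planeSection K α β c)) := by
  have hD2 : 1 + α ^ 2 + β ^ 2 = √(1 + α ^ 2 + β ^ 2) ^ 2 := (Real.sq_sqrt (by positivity)).symm
  rw [sectionArea_eq hK, chartWeight, ← mul_assoc (ENNReal.ofReal (_ ^ 3)),
    ← ENNReal.ofReal_mul (by positivity), mul_left_comm,
    ← ENNReal.ofReal_pow (by positivity)]
  congr 2
  generalize √(1 + α ^ 2 + β ^ 2) = D at *
  rw [hD2]
  ring

lemma chartWeight_mul_sectionArea_le {K : Set E3} (hK : IsCompact K) (hconv : Convex ℝ K)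
    (p : ℝ × ℝ × ℝ) : ENNReal.ofReal (4 * Real.pi) *
      (chartWeight (1 + p.1 ^ 2 + p.2.1 ^ 2) * sectionArea K p) ≤ planeWidth K p ^ 2 := by
  obtain ⟨α, β, c⟩ := p
  rw [chartWeight_mul_sectionArea hK, planeWidth_eq hK, mul_pow]
  gcongr
  exact four_pi_mul_volume_le_linesMeasure_sq (isCompact_planeSection hK α β c)
    (convex_planeSection hconv α β c)

lemma lintegral_planeWidth_lower {K : Set E3} (hK : IsCompact K) :
    ∫⁻ p : ℝ × ℝ × ℝ, ENNReal.ofReal (4 * Real.pi) *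
      (chartWeight (1 + p.1 ^ 2 + p.2.1 ^ 2) * sectionArea K p) =
      ENNReal.ofReal (4 * Real.pi ^ 2) * volume K + ENNReal.ofReal (4 * Real.pi ^ 2) * volume K := by
  rw [lintegral_const_mul' _ _ ENNReal.ofReal_ne_top, lintegral_chartWeight_mul_sectionArea hK,
    ← mul_assoc, ← add_mul, ← ENNReal.ofReal_mul (by positivity),
    ← ENNReal.ofReal_add (by positivity) (by positivity)]
  congr 2
  ring

/-- Finiteness: a section fits in a disc of radius 2R about one of its points, and only planes at
distance at most R from the origin meet K. Integrating over c gives 2RD · D⁻⁴, a multiple of the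
integrable `chartWeight`. -/
lemma planeWidth_sq_le {K : Set E3} (hK : IsCompact K) (hconv : Convex ℝ K) {R : ℝ} (hR : 0 ≤ R)
    (hKR : ∀ X ∈ K, ‖X‖ ≤ R) (α β c : ℝ) : planeWidth K (α, β, c) ^ 2 ≤
      ENNReal.ofReal ((1 + α ^ 2 + β ^ 2)⁻¹ ^ 2 * (4 * Real.pi * R) ^ 2) *
      (Set.Icc (-(R * √(1 + α ^ 2 + β ^ 2))) (R * √(1 + α ^ 2 + β ^ 2))).indicator 1 c := by
  have hpi := Real.pi_pos
  rcases (planeSection K α β c).eq_empty_or_nonempty with h | ⟨p₀, hp₀⟩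
  · rw [planeWidth_eq hK, h]
    simp [linesMeasure, lineIntercepts]
  have hc : c ∈ Set.Icc (-(R * √(1 + α ^ 2 + β ^ 2))) (R * √(1 + α ^ 2 + β ^ 2)) := by
    rw [Set.mem_Icc, ← abs_le]
    have h1 := planePoint_mem_plane α β c p₀
    have h2 := hKR _ hp₀
    set X := planePoint α β c p₀
    have h3 : ‖X‖ ^ 2 = X 0 ^ 2 + X 1 ^ 2 + X 2 ^ 2 := by
      rw [← vec3_eta X, norm_vec3_sq]; rfl
    have hc : c = X 2 - β * X 0 - α * X 1 := by linarith
    refine abs_le_of_sq_le_sq ?_ (by positivity)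
    rw [mul_pow, Real.sq_sqrt (by positivity)]
    have h4 : c ^ 2 ≤ ‖X‖ ^ 2 * (1 + α ^ 2 + β ^ 2) := by
      rw [h3, hc]
      -- Cauchy–Schwarz for X and (-β, -α, 1); the hints are the squares in Lagrange's identity.
      nlinarith [sq_nonneg (X 0 + β * X 2), sq_nonneg (X 1 + α * X 2), sq_nonneg (β * X 1 - α * X 0)]
    refine h4.trans ?_
    gcongr
  rw [Set.indicator_of_mem hc, Pi.one_apply, mul_one, planeWidth_eq hK,
    ← mul_pow, ENNReal.ofReal_pow (by positivity), ENNReal.ofReal_mul (by positivity)]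
  gcongr
  have h := linesMeasure_le (isCompact_planeSection hK α β c) (convex_planeSection hconv α β c)
    (c := p₀) (r := 2 * R) (by positivity) fun p hp => by
      rw [Set.mem_ofPred_eq, ← norm_planePoint_sub_sq α β c]
      have := norm_sub_le (planePoint α β c p) (planePoint α β c p₀)
      have h1 := hKR _ hp
      have h2 := hKR _ hp₀
      gcongr
      linarith
  rwa [show 4 * Real.pi * R = 2 * Real.pi * (2 * R) by ring]

lemma lintegral_planeWidth_sq_lt_top {K : Set E3} (hK : IsCompact K) (hconv : Convex ℝ K) :
    ∫⁻ p, planeWidth K p ^ 2 < ⊤ := by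
  obtain ⟨R, hR0, hKR⟩ : ∃ R : ℝ, 0 ≤ R ∧ ∀ X ∈ K, ‖X‖ ≤ R := by
    obtain ⟨R, hR⟩ := hK.isBounded.exists_norm_le
    exact ⟨max R 0, le_max_right _ _, fun X hX => (hR X hX).trans (le_max_left _ _)⟩
  have hm : Measurable fun p => planeWidth K p ^ 2 := (measurable_planeWidth hK).pow_const 2
  rw [Measure.volume_eq_prod, lintegral_prod _ hm.aemeasurable]
  have hslice : ∀ α : ℝ, ∫⁻ q : ℝ × ℝ, planeWidth K (α, q) ^ 2 ≤
      ENNReal.ofReal ((4 * Real.pi * R) ^ 2 * (2 * R)) *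
        ∫⁻ β : ℝ, chartWeight (1 + α ^ 2 + β ^ 2) := by
    intro α
    rw [Measure.volume_eq_prod, lintegral_prod (fun q : ℝ × ℝ => planeWidth K (α, q) ^ 2)
      (hm.comp (measurable_prodMk_left (x := α))).aemeasurable,
      ← lintegral_const_mul' _ _ ENNReal.ofReal_ne_top]
    refine lintegral_mono fun β => ?_
    refine (lintegral_mono fun c => planeWidth_sq_le hK hconv hR0 hKR α β c).trans (le_of_eq ?_)
    rw [lintegral_const_mul' _ _ ENNReal.ofReal_ne_top, lintegral_indicator_one measurableSet_Icc,
      Real.volume_Icc, chartWeight, ← ENNReal.ofReal_mul (by positivity),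
      ← ENNReal.ofReal_mul (by positivity)]
    congr 1
    have hD2 : 1 + α ^ 2 + β ^ 2 = √(1 + α ^ 2 + β ^ 2) ^ 2 := (Real.sq_sqrt (by positivity)).symm
    have hD : 0 < √(1 + α ^ 2 + β ^ 2) := by positivity
    generalize √(1 + α ^ 2 + β ^ 2) = D at *
    rw [hD2]
    field_simp
    ring
  refine (lintegral_mono hslice).trans_lt ?_
  rw [lintegral_const_mul' _ _ ENNReal.ofReal_ne_top, lintegral_chartWeight]
  exact ENNReal.mul_lt_top ENNReal.ofReal_lt_top ENNReal.ofReal_lt_top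

lemma lintegral_planeWidth_sq_eq {K : Set E3} (hK : IsCompact K) (hconv : Convex ℝ K) :
    ∫⁻ p, planeWidth K p ^ 2 = (∫⁻ P in Kᶜ, ENNReal.ofReal (sphereArea (solidAngle K P) ^ 2)) +
      ENNReal.ofReal (4 * Real.pi ^ 2) * volume K := by
  rw [← lintegral_lineArea_sq_eq_planeWidth hK, lintegral_lineArea_sq hK hconv]

lemma integrableOn_sphereArea_sq {K : Set E3} (hK : IsCompact K) (hconv : Convex ℝ K) :
    IntegrableOn (fun P : E3 => sphereArea (solidAngle K P) ^ 2) Kᶜ volume := by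
  constructor
  · have hm : Measurable fun P => (lineArea K P).toReal ^ 2 :=
      (measurable_lineArea hK).ennreal_toReal.pow_const 2
    refine hm.aestronglyMeasurable.congr ?_
    filter_upwards [ae_restrict_mem hK.measurableSet.compl] with P hP
    rw [sphereArea, toSphere_solidAngle hK hconv hP]
  · rw [hasFiniteIntegral_iff_ofReal (Eventually.of_forall fun P => sq_nonneg _)]
    have h := lintegral_planeWidth_sq_lt_top hK hconv
    rw [lintegral_planeWidth_sq_eq hK hconv] at h
    exact (le_self_add).trans_lt h

lemma lintegral_planeWidth_sq_eq_ofReal {K : Set E3} (hK : IsCompact K) (hconv : Convex ℝ K) :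
    ∫⁻ p, planeWidth K p ^ 2 = ENNReal.ofReal ((∫ P in Kᶜ, sphereArea (solidAngle K P) ^ 2) +
      4 * Real.pi ^ 2 * (volume K).toReal) := by
  rw [lintegral_planeWidth_sq_eq hK hconv, ENNReal.ofReal_add (integral_nonneg fun P => sq_nonneg _)
    (by positivity), ofReal_integral_eq_lintegral_ofReal (integrableOn_sphereArea_sq hK hconv)
    (Eventually.of_forall fun P => sq_nonneg _), ENNReal.ofReal_mul (p := 4 * Real.pi ^ 2) (by positivity),
    ENNReal.ofReal_toReal hK.measure_lt_top.ne]

lemma lintegral_planeWidth_lower_eq_ofReal {K : Set E3} (hK : IsCompact K) :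
    ∫⁻ p : ℝ × ℝ × ℝ, ENNReal.ofReal (4 * Real.pi) *
      (chartWeight (1 + p.1 ^ 2 + p.2.1 ^ 2) * sectionArea K p) =
      ENNReal.ofReal (4 * Real.pi ^ 2 * (volume K).toReal +
        4 * Real.pi ^ 2 * (volume K).toReal) := by
  rw [lintegral_planeWidth_lower hK, ENNReal.ofReal_add (by positivity) (by positivity),
    ENNReal.ofReal_mul (p := 4 * Real.pi ^ 2) (by positivity),
    ENNReal.ofReal_toReal hK.measure_lt_top.ne]

lemma four_pi_sq_mul_volume_le_integral {K : Set E3} (hK : IsCompact K) (hconv : Convex ℝ K) :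
    4 * Real.pi ^ 2 * (volume K).toReal ≤ ∫ P in Kᶜ, sphereArea (solidAngle K P) ^ 2 := by
  have h := lintegral_mono (μ := volume) fun p => chartWeight_mul_sectionArea_le hK hconv p
  rw [lintegral_planeWidth_lower_eq_ofReal hK, lintegral_planeWidth_sq_eq_ofReal hK hconv,
    ENNReal.ofReal_le_ofReal_iff] at h
  · linarith
  · exact add_nonneg (integral_nonneg fun P => sq_nonneg _) (by positivity)

/-- Equality in the solid angle inequality is equality in the isoperimetric inequality for almost
every plane section. -/
lemma integral_eq_iff_ae {K : Set E3} (hK : IsCompact K) (hconv : Convex ℝ K) :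
    (∫ P in Kᶜ, sphereArea (solidAngle K P) ^ 2) = 4 * Real.pi ^ 2 * (volume K).toReal ↔
      ∀ᵐ p : ℝ × ℝ × ℝ, linesMeasure (planeSection K p.1 p.2.1 p.2.2) ^ 2 =
        ENNReal.ofReal (4 * Real.pi) * volume (planeSection K p.1 p.2.1 p.2.2) := by
  have hiff : ∀ p : ℝ × ℝ × ℝ, linesMeasure (planeSection K p.1 p.2.1 p.2.2) ^ 2 =
      ENNReal.ofReal (4 * Real.pi) * volume (planeSection K p.1 p.2.1 p.2.2) ↔
      ENNReal.ofReal (4 * Real.pi) * (chartWeight (1 + p.1 ^ 2 + p.2.1 ^ 2) * sectionArea K p) =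
        planeWidth K p ^ 2 := by
    rintro ⟨α, β, c⟩
    rw [chartWeight_mul_sectionArea hK, planeWidth_eq hK, mul_pow, ENNReal.mul_right_inj, eq_comm]
    · have : 0 < (1 + α ^ 2 + β ^ 2)⁻¹ := by positivity
      exact pow_ne_zero _ (ENNReal.ofReal_pos.2 this).ne'
    · exact ENNReal.pow_ne_top ENNReal.ofReal_ne_top
  simp_rw [hiff]
  have hle := fun p => chartWeight_mul_sectionArea_le hK hconv p
  have h1 := lintegral_planeWidth_lower_eq_ofReal hK
  have h2 := lintegral_planeWidth_sq_eq_ofReal hK hconv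
  have hnn : 0 ≤ ∫ P in Kᶜ, sphereArea (solidAngle K P) ^ 2 := integral_nonneg fun P => sq_nonneg _
  constructor
  · intro h
    refine ae_eq_of_ae_le_of_lintegral_le (Eventually.of_forall hle) ?_
      ((measurable_planeWidth hK).pow_const 2).aemeasurable ?_
    · rw [h1]; exact ENNReal.ofReal_ne_top
    · rw [h1, h2, h]
  · intro h
    have h3 := lintegral_congr_ae h
    rw [h1, h2, ENNReal.ofReal_eq_ofReal_iff (by positivity) (by positivity)] at h3
    linarith

/-! ### Equality for balls and for collinear sets -/

lemma norm_sub_sq_coord (X Y : E3) :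
    ‖X - Y‖ ^ 2 = (X 0 - Y 0) ^ 2 + (X 1 - Y 1) ^ 2 + (X 2 - Y 2) ^ 2 := by
  rw [EuclideanSpace.norm_sq_eq, Fin.sum_univ_three]
  simp [Real.norm_eq_abs, sq_abs]

lemma linesMeasure_sq_planeSection_closedBall (C : E3) (r α β c : ℝ) :
    linesMeasure (planeSection (Metric.closedBall C r) α β c) ^ 2 =
      ENNReal.ofReal (4 * Real.pi) * volume (planeSection (Metric.closedBall C r) α β c) := by
  rcases (planeSection (Metric.closedBall C r) α β c).eq_empty_or_nonempty with h | ⟨q, hq⟩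
  · simp [h, linesMeasure, lineIntercepts]
  have hr : 0 ≤ r := dist_nonneg.trans (Metric.mem_closedBall.1 hq)
  -- δ is chosen so that C + δ(β, α, -1), the foot of the perpendicular from C, lies in the plane;
  -- `key` is then Pythagoras.
  obtain ⟨δ, hδ⟩ : ∃ δ, C 2 - c - β * C 0 - α * C 1 = δ * (1 + α ^ 2 + β ^ 2) :=
    ⟨(C 2 - c - β * C 0 - α * C 1) / (1 + α ^ 2 + β ^ 2), by field_simp⟩
  set F : E3 := vec3 (C 0 + δ * β) (C 1 + δ * α) (C 2 - δ) with hF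
  have hFp : F 2 = c + β * F 0 + α * F 1 := by simp only [hF, vec3_zero, vec3_one, vec3_two]; linarith
  have key : ∀ p, ‖planePoint α β c p - C‖ ^ 2 =
      ((p.1 - (planeCoord α β F).1) ^ 2 + (p.2 - (planeCoord α β F).2) ^ 2) + ‖F - C‖ ^ 2 := by
    intro p
    rw [← norm_planePoint_sub_sq α β c, planePoint_planeCoord hFp]
    have hp := planePoint_mem_plane α β c p
    simp only [norm_sub_sq_coord, hF, vec3_zero, vec3_one, vec3_two, hp]
    linear_combination (2 * δ) * hδ
  have hmem : ∀ p, p ∈ planeSection (Metric.closedBall C r) α β c ↔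
      (p.1 - (planeCoord α β F).1) ^ 2 + (p.2 - (planeCoord α β F).2) ^ 2 ≤
        r ^ 2 - ‖F - C‖ ^ 2 := by
    intro p
    rw [planeSection, Set.mem_preimage, mem_closedBall_iff_norm, ← abs_norm,
      ← abs_of_nonneg hr, ← sq_le_sq, key, abs_of_nonneg hr, le_sub_iff_add_le]
  have hnn : 0 ≤ r ^ 2 - ‖F - C‖ ^ 2 := le_trans (by positivity) ((hmem q).1 hq)
  refine linesMeasure_sq_disc (isCompact_planeSection (isCompact_closedBall C r) α β c)
    (convex_planeSection (convex_closedBall C r) α β c) (Real.sqrt_nonneg _)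
    (c := planeCoord α β F) (r := √(r ^ 2 - ‖F - C‖ ^ 2)) ?_
  ext p
  rw [hmem, Set.mem_ofPred_eq, Real.sq_sqrt hnn]

lemma integral_sphereArea_sq_closedBall (C : E3) (r : ℝ) :
    ∫ P in (Metric.closedBall C r)ᶜ, sphereArea (solidAngle (Metric.closedBall C r) P) ^ 2 =
      4 * Real.pi ^ 2 * (volume (Metric.closedBall C r)).toReal :=
  (integral_eq_iff_ae (isCompact_closedBall C r) (convex_closedBall C r)).2
    (.of_forall fun _ => linesMeasure_sq_planeSection_closedBall ..)

lemma sphereArea_solidAngle_toReal (K : Set E3) (P : E3) (hK : IsCompact K) :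
    sphereArea (solidAngle K P) = 3 * (volume {x : E3 | x ≠ 0 ∧ ‖x‖ < 1 ∧
      ∃ t : ℝ, 0 ≤ t ∧ P + t • x ∈ K}).toReal := by
  have h : Set.Ioo (0 : ℝ) 1 • (Subtype.val '' solidAngle K P : Set E3) =
      {x : E3 | x ≠ 0 ∧ ‖x‖ < 1 ∧ ∃ t : ℝ, 0 ≤ t ∧ P + t • x ∈ K} := by
    ext x; exact mem_cone_solidAngle
  rw [sphereArea, Measure.toSphere_apply' _ (measurableSet_solidAngle hK P), h]
  simp

lemma volume_span_pair_eq_zero (v w : E3) :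
    volume (Submodule.span ℝ {v, w} : Set E3) = 0 := by
  refine Measure.addHaar_submodule _ _ fun h => ?_
  have h1 : Module.finrank ℝ (Submodule.span ℝ ({v, w} : Set E3)) ≤ 2 := by
    classical
    have := finrank_span_finset_le_card (R := ℝ) ({v, w} : Finset E3)
    rw [Finset.coe_pair] at this
    exact this.trans (Finset.card_le_two)
  rw [h, finrank_top, finrank_euclideanSpace_fin] at h1
  omega

lemma integral_sphereArea_sq_of_collinear {K : Set E3} (hK : IsCompact K) (h : Collinear ℝ K) :
    ∫ P in Kᶜ, sphereArea (solidAngle K P) ^ 2 = 4 * Real.pi ^ 2 * (volume K).toReal := by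
  obtain ⟨A, v, hA⟩ := (collinear_iff_exists_forall_eq_smul_vadd K).1 h
  have hvol : volume K = 0 := by
    have h0 : volume ((fun x => x + A) ⁻¹' K) = 0 := by
      refine measure_mono_null (fun x hx => ?_) (volume_span_pair_eq_zero v v)
      obtain ⟨s, hs⟩ := hA _ hx
      rw [vadd_eq_add, add_left_inj] at hs
      rw [hs]
      exact Submodule.smul_mem _ _ (Submodule.subset_span (by simp))
    rwa [measure_preimage_add_right] at h0
  have hzero : ∀ P ∈ Kᶜ, sphereArea (solidAngle K P) ^ 2 = 0 := by
    intro P hP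
    -- All directions from P to the line A + ℝv lie in the span of v and A - P, which is null.
    rw [sphereArea_solidAngle_toReal K P hK, measure_mono_null _
      (volume_span_pair_eq_zero v (A - P))]
    · simp
    rintro x ⟨-, -, t, ht, hx⟩
    obtain ⟨s, hs⟩ := hA _ hx
    have ht0 : t ≠ 0 := by rintro rfl; exact hP (by simpa using hx)
    have : x = t⁻¹ • (s • v + (A - P)) := by
      rw [eq_inv_smul_iff₀ ht0, ← add_sub_assoc, ← vadd_eq_add, ← hs]; abel
    rw [this]
    exact Submodule.smul_mem _ _ (add_mem (Submodule.smul_mem _ _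
      (Submodule.subset_span (by simp))) (Submodule.subset_span (by simp)))
  rw [setIntegral_congr_fun hK.measurableSet.compl hzero, hvol]
  simp

/-! ### Equality for sets without interior -/

lemma affineSpan_insert_eq_top {K : Set E3} (hne : K.Nonempty) (hcol : ¬ Collinear ℝ K) {P : E3}
    (hP : P ∉ affineSpan ℝ K) : affineSpan ℝ (insert P K) = ⊤ := by
  have hle : affineSpan ℝ K ≤ affineSpan ℝ (insert P K) :=
    affineSpan_mono ℝ (Set.subset_insert P K)
  have hlt : (affineSpan ℝ K).direction < (affineSpan ℝ (insert P K)).direction := by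
    refine lt_of_le_of_ne (AffineSubspace.direction_le hle) fun h => hP ?_
    rw [AffineSubspace.eq_of_direction_eq_of_nonempty_of_le h ((affineSpan_nonempty ℝ).2 hne) hle]
    exact subset_affineSpan ℝ _ (Set.mem_insert P K)
  have h2 := Submodule.finrank_lt_finrank_of_lt hlt
  rw [collinear_iff_finrank_le_one, ← direction_affineSpan] at hcol
  have h3 : (affineSpan ℝ (insert P K)).direction = ⊤ := by
    refine Submodule.eq_top_of_finrank_eq (le_antisymm (Submodule.finrank_le _) ?_)
    rw [finrank_euclideanSpace_fin]; omega
  exact (AffineSubspace.direction_eq_top_iff_of_nonempty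
    ((affineSpan_nonempty ℝ).2 (Set.insert_nonempty P K))).1 h3

/-- The convex hull of P and K has interior points arbitrarily close to P, and every point of it
other than P lies on a ray from P that meets K. -/
lemma sphereArea_solidAngle_pos {K : Set E3} (hK : IsCompact K) (hconv : Convex ℝ K)
    (hcol : ¬ Collinear ℝ K) {P : E3} (hP : P ∉ affineSpan ℝ K) :
    0 < sphereArea (solidAngle K P) := by
  have hne : K.Nonempty := by
    by_contra! h; exact hcol (h ▸ collinear_empty ℝ E3)
  set T := convexHull ℝ (insert P K) with hT
  have hPT : P ∈ T := subset_convexHull ℝ _ (Set.mem_insert P K)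
  have hTc : Convex ℝ T := convex_convexHull ℝ _
  have hint : (interior T).Nonempty := by
    rw [hT, interior_convexHull_nonempty_iff_affineSpan_eq_top]
    exact affineSpan_insert_eq_top hne hcol hP
  have hcl : P ∈ closure (interior T) := by
    rw [hTc.closure_interior_eq_closure_of_nonempty_interior hint]
    exact subset_closure hPT
  obtain ⟨Q, hQ1, hQ2⟩ := mem_closure_iff.1 hcl _ Metric.isOpen_ball (Metric.mem_ball_self one_pos)
  set U := Metric.ball P 1 ∩ interior T
  have hU : 0 < volume U :=
    (Metric.isOpen_ball.inter isOpen_interior).measure_pos _ ⟨Q, hQ1, hQ2⟩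
  rw [sphereArea_solidAngle_toReal K P hK]
  refine mul_pos three_pos (ENNReal.toReal_pos (ne_of_gt ?_) (ne_of_lt ?_))
  · have hU' : 0 < volume ((fun x => x + P) ⁻¹' (U \ {P})) := by
      rw [measure_preimage_add_right, measure_sdiff_null (measure_singleton P)]
      exact hU
    refine hU'.trans_le (measure_mono ?_)
    rintro x ⟨⟨hx1, hx2⟩, hx3⟩
    refine ⟨fun h => hx3 (by simp [h]), by simpa using hx1, ?_⟩
    have := interior_subset hx2
    rw [hT, convexHull_insert hne, hconv.convexHull_eq, mem_convexJoin] at this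
    obtain ⟨P', rfl, X, hX, a, b, ha, hb, hab, h⟩ := this
    have hb0 : b ≠ 0 := by
      rintro rfl
      rw [add_zero] at hab
      apply hx3
      rw [← h, hab]; simp
    refine ⟨b⁻¹, by positivity, ?_⟩
    have hx : x = b • (X - P') := by
      rw [← eq_sub_iff_add_eq] at hab
      simp only at h
      rw [← sub_eq_iff_eq_add.2 h, hab]; module
    rw [hx, smul_smul, inv_mul_cancel₀ hb0]
    simpa using hX
  · refine (measure_mono ?_).trans_lt (measure_ball_lt_top (μ := volume) (x := (0 : E3)) (r := 1))
    rintro x ⟨-, hx, -⟩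
    simpa using hx

/-- Here K is null, so equality would make the solid angle vanish almost everywhere outside K. It is
positive off the proper, hence null, affine span of K unless K is collinear. -/
lemma collinear_of_integral_eq_zero {K : Set E3} (hK : IsCompact K) (hconv : Convex ℝ K)
    (hint : interior K = ∅)
    (h : ∫ P in Kᶜ, sphereArea (solidAngle K P) ^ 2 = 4 * Real.pi ^ 2 * (volume K).toReal) :
    Collinear ℝ K := by
  by_contra hcol
  have hspan : affineSpan ℝ K ≠ ⊤ := fun h' =>
    (hconv.interior_nonempty_iff_affineSpan_eq_top.2 h').ne_empty hint
  have hnull := Measure.addHaar_affineSubspace volume _ hspan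
  have hvol : volume K = 0 := measure_mono_null (subset_affineSpan ℝ K) hnull
  rw [hvol, ENNReal.toReal_zero, mul_zero, integral_eq_zero_iff_of_nonneg (fun _ => sq_nonneg _)
    (integrableOn_sphereArea_sq hK hconv), Filter.EventuallyEq,
    ae_restrict_iff' hK.measurableSet.compl] at h
  obtain ⟨P, hP1, hP2⟩ := (h.and (measure_eq_zero_iff_ae_notMem.1 hnull)).exists
  have hpos := sphereArea_solidAngle_pos hK hconv hcol hP2
  have := hP1 fun hPK => hP2 (subset_affineSpan ℝ K hPK)
  simp only [Pi.zero_apply] at this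
  exact (pow_pos hpos 2).ne' this

/-! ### Sets with interior: disc sections force a ball -/

/-- The plane with equation `⟪q.1, X⟫ = q.2`. -/
def orthPlane (q : E3 × ℝ) : Set E3 := {X | inner ℝ q.1 X = q.2}

/-- The orthogonal projection onto `orthPlane q`. -/
noncomputable def planeProj (q : E3 × ℝ) (Z : E3) : E3 :=
  Z - ((inner ℝ q.1 Z - q.2) / ‖q.1‖ ^ 2) • q.1

lemma planeProj_mem {q : E3 × ℝ} (hq : q.1 ≠ 0) (Z : E3) : planeProj q Z ∈ orthPlane q := by
  have : ‖q.1‖ ≠ 0 := norm_ne_zero_iff.2 hq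
  rw [orthPlane, Set.mem_ofPred_eq, planeProj, inner_sub_right, inner_smul_right,
    real_inner_self_eq_norm_sq]
  field_simp
  ring

lemma planeProj_eq {q : E3 × ℝ} {Z : E3} (hZ : Z ∈ orthPlane q) : planeProj q Z = Z := by
  rw [orthPlane, Set.mem_ofPred_eq] at hZ
  simp [planeProj, hZ]

lemma tendsto_planeProj {q : E3 × ℝ} (hq : q.1 ≠ 0) {Z : E3} (hZ : Z ∈ orthPlane q) :
    Tendsto (fun q' => planeProj q' Z) (𝓝 q) (𝓝 Z) := by
  have h : ContinuousAt (fun q' => planeProj q' Z) q := by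
    have h0 : ‖q.1‖ ^ 2 ≠ 0 := pow_ne_zero 2 (norm_ne_zero_iff.2 hq)
    have hn : ContinuousAt (fun q' : E3 × ℝ => (inner ℝ q'.1 Z - q'.2) / ‖q'.1‖ ^ 2) q :=
      ContinuousAt.div (by fun_prop) (by fun_prop) h0
    exact continuousAt_const.sub (hn.smul continuousAt_fst)
  have h' := h.tendsto
  rwa [planeProj_eq hZ] at h'

/-- The plane `q` meets the interior of `K`, if at all, in a disc. -/
def IsDiscSection (K : Set E3) (q : E3 × ℝ) : Prop :=
  (interior K ∩ orthPlane q).Nonempty → ∃ (C : E3) (r : ℝ), 0 ≤ r ∧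
    (∀ X ∈ orthPlane q, X ∈ K ↔ ‖X - C‖ ≤ r) ∧ ∃ X ∈ K, ∃ Y ∈ K, ‖X - Y‖ = 2 * r

lemma isDiscSection_of_linesMeasure {K : Set E3} (hK : IsCompact K) (hconv : Convex ℝ K)
    {α β c l : ℝ} (hl : l ≠ 0)
    (h : linesMeasure (planeSection K α β c) ^ 2 =
      ENNReal.ofReal (4 * Real.pi) * volume (planeSection K α β c)) :
    IsDiscSection K (l • vec3 (-β) (-α) 1, l * c) := by
  have hmem : ∀ X, X ∈ orthPlane (l • vec3 (-β) (-α) 1, l * c) ↔ X 2 = c + β * X 0 + α * X 1 := by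
    intro X
    simp only [orthPlane, Set.mem_ofPred_eq, PiLp.inner_apply, Fin.sum_univ_three, PiLp.smul_apply,
      vec3_zero, vec3_one, vec3_two, smul_eq_mul, RCLike.inner_apply, conj_trivial]
    constructor
    · intro h
      apply mul_left_cancel₀ hl
      linear_combination h
    · intro h
      linear_combination l * h
  rintro ⟨X₀, hX₀, hX₀'⟩
  rw [hmem] at hX₀'
  have hint : (interior (planeSection K α β c)).Nonempty := by
    refine ⟨planeCoord α β X₀, interior_maximal (s := planeSection K α β c)
      (t := planePoint α β c ⁻¹' interior K) (Set.preimage_mono interior_subset)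
      (isOpen_interior.preimage (continuous_planePoint α β c)) ?_⟩
    rwa [Set.mem_preimage, planePoint_planeCoord hX₀']
  obtain ⟨z, r, hr, hS⟩ := exists_disc_of_linesMeasure_sq_le (isCompact_planeSection hK α β c)
    (convex_planeSection hconv α β c) hint h.le
  have hS' : ∀ p, planePoint α β c p ∈ K ↔ (p.1 - z.1) ^ 2 + (p.2 - z.2) ^ 2 ≤ r ^ 2 := by
    intro p
    exact Set.ext_iff.1 hS p
  refine ⟨planePoint α β c z, r, hr, fun X hX => ?_, planePoint α β c (z.1 + r, z.2), ?_,
    planePoint α β c (z.1 - r, z.2), ?_, ?_⟩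
  · rw [hmem] at hX
    rw [← planePoint_planeCoord hX, hS', ← norm_planePoint_sub_sq α β c,
      pow_le_pow_iff_left₀ (norm_nonneg _) hr two_ne_zero]
  · rw [hS']; simp
  · rw [hS']; simp
  · rw [← pow_left_inj₀ (norm_nonneg _) (by positivity) two_ne_zero, norm_planePoint_sub_sq]
    simp only; ring

/-- A property of almost every (α, β, c) holds on a dense set. Homogeneous plane coordinates
(normal, offset) are used because planes parallel to the z-axis are missing from the chart but are
limits of planes in it. -/
lemma dense_isDiscSection {K : Set E3} (hK : IsCompact K) (hconv : Convex ℝ K)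
    (h : ∀ᵐ p : ℝ × ℝ × ℝ, linesMeasure (planeSection K p.1 p.2.1 p.2.2) ^ 2 =
      ENNReal.ofReal (4 * Real.pi) * volume (planeSection K p.1 p.2.1 p.2.2)) :
    Dense {q | IsDiscSection K q ∧ q.1 ≠ 0} := by
  set Φ : ℝ × ℝ × ℝ × ℝ → E3 × ℝ :=
    fun w => (w.1 • vec3 (-w.2.2.1) (-w.2.1) 1, w.1 * w.2.2.2) with hΦ
  have hΦc : Continuous Φ := by fun_prop
  have hrange : DenseRange Φ := by
    rintro ⟨n, d⟩
    -- The chart reaches exactly the normals with nonzero third coordinate, so n is perturbed in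
    -- that coordinate.
    have hlim : Tendsto (fun t : ℝ => (n + t • vec3 0 0 1, d)) (𝓝[≠] (-(n 2) + n 2)) (𝓝 (n, d)) := by
      have : Continuous fun t : ℝ => (n + t • vec3 0 0 1, d) := by fun_prop
      have h' := (this.tendsto 0).mono_left (nhdsWithin_le_nhds (s := {0}ᶜ))
      simpa using h'
    rw [neg_add_cancel] at hlim
    have hev : ∀ᶠ t : ℝ in 𝓝[≠] 0, n 2 + t ≠ 0 := by
      by_cases hn : n 2 = 0
      · filter_upwards [self_mem_nhdsWithin] with t ht
        simpa [hn] using ht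
      · have : ContinuousAt (fun t : ℝ => n 2 + t) 0 := by fun_prop
        exact (this.eventually_ne (by simpa using hn)).filter_mono nhdsWithin_le_nhds
    refine mem_closure_of_tendsto hlim (hev.mono fun t ht => ?_)
    refine ⟨(n 2 + t, -(n 1 / (n 2 + t)), -(n 0 / (n 2 + t)), d / (n 2 + t)), ?_⟩
    rw [← vec3_eta n, smul_vec3, vec3_add]
    simp only [hΦ, smul_vec3, vec3_two, neg_neg, vec3_zero, vec3_one]
    congr 1
    · congr 1 <;> field_simp <;> ring
    · field_simp
  have hd := ((dense_compl_singleton (0 : ℝ)).prod (Measure.dense_of_ae h))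
  refine (hrange.dense_image hΦc hd).mono ?_
  rintro _ ⟨⟨l, α, β, c⟩, ⟨hl, hp⟩, rfl⟩
  refine ⟨isDiscSection_of_linesMeasure hK hconv hl hp, fun h0 => ?_⟩
  have := congrArg (fun X : E3 => X 2) h0
  simp [hΦ] at this
  exact hl this

/-- By the parallelogram law, the centre of a ball of radius at most R that contains A and B
approaches their midpoint as |A - B| approaches 2R. -/
lemma norm_sub_midpoint_le {A B C : E3} {r R : ℝ} (hrR : r ≤ R) (hA : ‖A - C‖ ≤ r)
    (hB : ‖B - C‖ ≤ r) : ‖C - midpoint ℝ A B‖ ≤ √(R ^ 2 - ‖A - B‖ ^ 2 / 4) := by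
  apply Real.le_sqrt_of_sq_le
  have hp := parallelogram_law_with_norm ℝ (A - C) (B - C)
  have h1 : A - C + (B - C) = -(2 : ℝ) • (C - midpoint ℝ A B) := by
    rw [midpoint_eq_smul_add, invOf_eq_inv]; module
  have h2 : A - C - (B - C) = A - B := by abel
  rw [h1, h2, norm_smul] at hp
  have h3 : ‖A - C‖ ^ 2 ≤ R ^ 2 := by gcongr; linarith
  have h4 : ‖B - C‖ ^ 2 ≤ R ^ 2 := by gcongr; linarith
  norm_num at hp
  nlinarith

/-- The bounds no longer mention the centre or radius of the disc, so they pass to limits of planes.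
The last clause of `IsDiscSection` is what gives r ≤ R. -/
lemma isDiscSection_bounds {K : Set E3} {R : ℝ} (hR : ∀ X ∈ K, ∀ Y ∈ K, ‖X - Y‖ ≤ 2 * R)
    {q : E3 × ℝ} (hq : IsDiscSection K q) {A B : E3} (hA : A ∈ interior K ∩ orthPlane q)
    (hB : B ∈ K ∩ orthPlane q) {Z : E3} (hZ : Z ∈ orthPlane q) :
    (Z ∈ K → ‖Z - midpoint ℝ A B‖ ≤ R + √(R ^ 2 - ‖A - B‖ ^ 2 / 4)) ∧
      (‖Z - midpoint ℝ A B‖ + √(R ^ 2 - ‖A - B‖ ^ 2 / 4) ≤ ‖A - B‖ / 2 → Z ∈ K) := by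
  obtain ⟨C, r, hr, hC, X, hX, Y, hY, hXY⟩ := hq ⟨A, hA⟩
  have hrR : r ≤ R := by have := hR X hX Y hY; linarith
  have hA' := (hC A hA.2).1 (interior_subset hA.1)
  have hB' := (hC B hB.2).1 hB.1
  have hm := norm_sub_midpoint_le hrR hA' hB'
  constructor
  · intro hZK
    have h1 := (hC Z hZ).1 hZK
    have h2 := norm_sub_le_norm_sub_add_norm_sub Z C (midpoint ℝ A B)
    linarith
  · intro h
    rw [hC Z hZ]
    have h2 := norm_sub_le_norm_sub_add_norm_sub Z (midpoint ℝ A B) C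
    have h3 := norm_sub_le_norm_sub_add_norm_sub A C B
    rw [norm_sub_rev C B] at h3
    rw [norm_sub_rev C] at hm
    linarith

/-- An arbitrary plane is approximated by disc planes, and A, B, Z are projected onto them. Interior
points stay in K under this perturbation; a strict hypothesis in the second claim survives it. -/
lemma bounds_of_interior {K : Set E3} (hK : IsCompact K)
    (hd : Dense {q | IsDiscSection K q ∧ q.1 ≠ 0}) {R : ℝ}
    (hR : ∀ X ∈ K, ∀ Y ∈ K, ‖X - Y‖ ≤ 2 * R) {q : E3 × ℝ} (hq : q.1 ≠ 0) {A B : E3}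
    (hA : A ∈ interior K ∩ orthPlane q) (hB : B ∈ interior K ∩ orthPlane q) {Z : E3}
    (hZ : Z ∈ orthPlane q) :
    (Z ∈ interior K → ‖Z - midpoint ℝ A B‖ ≤ R + √(R ^ 2 - ‖A - B‖ ^ 2 / 4)) ∧
      (‖Z - midpoint ℝ A B‖ + √(R ^ 2 - ‖A - B‖ ^ 2 / 4) < ‖A - B‖ / 2 → Z ∈ K) := by
  have : (𝓝[{q | IsDiscSection K q ∧ q.1 ≠ 0}] q).NeBot := mem_closure_iff_nhdsWithin_neBot.1 (hd q)
  have hl : ∀ {W : E3}, W ∈ orthPlane q → Tendsto (fun q' => planeProj q' W)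
      (𝓝[{q | IsDiscSection K q ∧ q.1 ≠ 0}] q) (𝓝 W) := fun hW =>
    (tendsto_planeProj hq hW).mono_left nhdsWithin_le_nhds
  have hi : ∀ {W : E3}, W ∈ interior K → W ∈ orthPlane q →
      ∀ᶠ q' in 𝓝[{q | IsDiscSection K q ∧ q.1 ≠ 0}] q, planeProj q' W ∈ interior K :=
    fun hW hW' => (hl hW').eventually (isOpen_interior.mem_nhds hW)
  have hAl := hl hA.2
  have hBl := hl hB.2
  have hZl := hl hZ
  have hmid : Tendsto (fun q' => ‖planeProj q' Z - midpoint ℝ (planeProj q' A) (planeProj q' B)‖)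
      (𝓝[{q | IsDiscSection K q ∧ q.1 ≠ 0}] q) (𝓝 ‖Z - midpoint ℝ A B‖) := by
    simp only [midpoint_eq_smul_add]
    exact (hZl.sub ((hAl.add hBl).const_smul _)).norm
  have hlen := (hAl.sub hBl).norm
  have hsq : Tendsto (fun q' => √(R ^ 2 - ‖planeProj q' A - planeProj q' B‖ ^ 2 / 4))
      (𝓝[{q | IsDiscSection K q ∧ q.1 ≠ 0}] q) (𝓝 √(R ^ 2 - ‖A - B‖ ^ 2 / 4)) :=
    ((tendsto_const_nhds.sub ((hlen.pow 2).div_const 4))).sqrt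
  constructor
  · intro hZi
    refine le_of_tendsto_of_tendsto hmid (tendsto_const_nhds.add hsq) ?_
    filter_upwards [self_mem_nhdsWithin, hi hA.1 hA.2, hi hB.1 hB.2, hi hZi hZ]
      with q' hq' h1 h2 h3
    exact (isDiscSection_bounds hR hq'.1 ⟨h1, planeProj_mem hq'.2 A⟩
      ⟨interior_subset h2, planeProj_mem hq'.2 B⟩ (planeProj_mem hq'.2 Z)).1 (interior_subset h3)
  · intro hlt
    refine hK.isClosed.mem_of_tendsto hZl ?_
    filter_upwards [self_mem_nhdsWithin, hi hA.1 hA.2, hi hB.1 hB.2,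
      (hmid.add hsq).eventually_lt (hlen.div_const 2) hlt] with q' hq' h1 h2 h3
    exact (isDiscSection_bounds hR hq'.1 ⟨h1, planeProj_mem hq'.2 A⟩
      ⟨interior_subset h2, planeProj_mem hq'.2 B⟩ (planeProj_mem hq'.2 Z)).2 h3.le

lemma convex_orthPlane (q : E3 × ℝ) : Convex ℝ (orthPlane q) := by
  intro X hX Y hY a b _ _ hab
  simp only [orthPlane, Set.mem_ofPred_eq] at *
  rw [inner_add_right, inner_smul_right, inner_smul_right, hX, hY, ← add_mul, hab, one_mul]

/-- The ends of a diameter are boundary points, so they are first moved slightly towards the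
interior point X₀. In the limit the square-root error vanishes and the section is pinned to the disc
with diameter AB. -/
lemma bounds_of_diameter {K : Set E3} (hK : IsCompact K) (hconv : Convex ℝ K)
    (hd : Dense {q | IsDiscSection K q ∧ q.1 ≠ 0}) {R : ℝ}
    (hR : ∀ X ∈ K, ∀ Y ∈ K, ‖X - Y‖ ≤ 2 * R) {q : E3 × ℝ} (hq : q.1 ≠ 0) {A B X₀ : E3}
    (hA : A ∈ K ∩ orthPlane q) (hB : B ∈ K ∩ orthPlane q) (hAB : ‖A - B‖ = 2 * R)
    (hX₀ : X₀ ∈ interior K ∩ orthPlane q) {Z : E3} (hZ : Z ∈ orthPlane q) :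
    (Z ∈ interior K → ‖Z - midpoint ℝ A B‖ ≤ R) ∧ (‖Z - midpoint ℝ A B‖ < R → Z ∈ K) := by
  have hmem : ∀ {W : E3}, W ∈ K ∩ orthPlane q → ∀ᶠ ε : ℝ in 𝓝[>] 0,
      (1 - ε) • W + ε • X₀ ∈ interior K ∩ orthPlane q := by
    intro W hW
    filter_upwards [Ioo_mem_nhdsGT (one_pos : (0 : ℝ) < 1)] with ε hε
    exact ⟨hconv.combo_self_interior_mem_interior hW.1 hX₀.1 (by linarith [hε.2]) hε.1 (by ring),
      convex_orthPlane q hW.2 hX₀.2 (by linarith [hε.2]) hε.1.le (by ring)⟩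
  have hl : ∀ W : E3, Tendsto (fun ε : ℝ => (1 - ε) • W + ε • X₀) (𝓝[>] 0) (𝓝 W) := by
    intro W
    have : Continuous fun ε : ℝ => (1 - ε) • W + ε • X₀ := by fun_prop
    have h := (this.tendsto 0).mono_left (nhdsWithin_le_nhds (s := Set.Ioi 0))
    simpa using h
  have hlen := ((hl A).sub (hl B)).norm
  rw [hAB] at hlen
  have hmid : Tendsto (fun ε : ℝ => ‖Z - midpoint ℝ ((1 - ε) • A + ε • X₀) ((1 - ε) • B + ε • X₀)‖)
      (𝓝[>] 0) (𝓝 ‖Z - midpoint ℝ A B‖) := by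
    simp only [midpoint_eq_smul_add]
    exact (tendsto_const_nhds.sub (((hl A).add (hl B)).const_smul _)).norm
  have hsq : Tendsto (fun ε : ℝ => √(R ^ 2 -
      ‖((1 - ε) • A + ε • X₀) - ((1 - ε) • B + ε • X₀)‖ ^ 2 / 4)) (𝓝[>] 0) (𝓝 0) := by
    have h := (tendsto_const_nhds (x := R ^ 2)).sub ((hlen.pow 2).div_const 4) |>.sqrt
    rwa [show R ^ 2 - (2 * R) ^ 2 / 4 = 0 by ring, Real.sqrt_zero] at h
  constructor
  · intro hZi
    have h := (tendsto_const_nhds (x := R)).add hsq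
    rw [add_zero] at h
    refine le_of_tendsto_of_tendsto hmid h ?_
    filter_upwards [hmem hA, hmem hB] with ε h1 h2
    exact (bounds_of_interior hK hd hR hq h1 h2 hZ).1 hZi
  · intro hlt
    have h := (hmid.add hsq).eventually_lt (hlen.div_const 2) (by linarith)
    obtain ⟨ε, h1, h2, h3⟩ := ((hmem hA).and ((hmem hB).and h)).exists
    exact (bounds_of_interior hK hd hR hq h1 h2 hZ).2 h3

/-- The differences span a null, hence proper, subspace even when the points are collinear, so a
nonzero normal always exists. -/
lemma exists_orthPlane (A B X : E3) :
    ∃ q : E3 × ℝ, q.1 ≠ 0 ∧ A ∈ orthPlane q ∧ B ∈ orthPlane q ∧ X ∈ orthPlane q := by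
  have hne : (Submodule.span ℝ {B - A, X - A})ᗮ ≠ ⊥ := by
    rw [Ne, Submodule.orthogonal_eq_bot_iff]
    intro h
    have h0 := volume_span_pair_eq_zero (B - A) (X - A)
    rw [h, Submodule.top_coe] at h0
    exact (Measure.measure_univ_ne_zero.2 (NeZero.ne _)) h0
  obtain ⟨n, hn, hn0⟩ := Submodule.exists_mem_ne_zero_of_ne_bot hne
  rw [Submodule.mem_orthogonal'] at hn
  have h : ∀ Y, Y - A ∈ Submodule.span ℝ {B - A, X - A} → Y ∈ orthPlane (n, inner ℝ n A) := by
    intro Y hY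
    have := hn _ hY
    rwa [inner_sub_right, sub_eq_zero] at this
  exact ⟨(n, inner ℝ n A), hn0, h A (by simp), h B (Submodule.subset_span (by simp)),
    h X (Submodule.subset_span (by simp))⟩

lemma exists_closedBall_of_dense {K : Set E3} (hK : IsCompact K) (hconv : Convex ℝ K)
    (hint : (interior K).Nonempty) (hd : Dense {q | IsDiscSection K q ∧ q.1 ≠ 0}) :
    ∃ (c : E3) (r : ℝ), 0 < r ∧ K = Metric.closedBall c r := by
  obtain ⟨X₀, hX₀⟩ := hint
  have hne : K.Nonempty := ⟨X₀, interior_subset hX₀⟩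
  obtain ⟨⟨A, B⟩, ⟨hA, hB⟩, hmax⟩ := (hK.prod hK).exists_isMaxOn (hne.prod hne)
    (f := fun p : E3 × E3 => ‖p.1 - p.2‖) (by fun_prop)
  obtain ⟨R, hAB⟩ : ∃ R, ‖A - B‖ = 2 * R := ⟨‖A - B‖ / 2, by ring⟩
  have hR : ∀ X ∈ K, ∀ Y ∈ K, ‖X - Y‖ ≤ 2 * R := by
    intro X hX Y hY
    rw [← hAB]
    exact hmax (a := (X, Y)) ⟨hX, hY⟩
  have hRpos : 0 < R := by
    obtain ⟨Y, hY, hYX⟩ := (infinite_of_mem_nhds X₀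
      (mem_interior_iff_mem_nhds.1 hX₀)).nontrivial.exists_ne X₀
    have h1 := hR Y hY X₀ (interior_subset hX₀)
    have h2 := norm_pos_iff.2 (sub_ne_zero.2 hYX)
    linarith
  set M := midpoint ℝ A B with hM
  have hMq : ∀ {q : E3 × ℝ}, A ∈ orthPlane q → B ∈ orthPlane q → M ∈ orthPlane q := by
    intro q h1 h2
    rw [hM, midpoint_eq_smul_add, smul_add]
    exact convex_orthPlane q h1 h2 (by simp) (by simp) (by norm_num)
  -- In the plane through A, B and X₀, K contains a point W slightly beyond M as seen from X₀. So M
  -- lies strictly between W and an interior point.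
  have hMint : M ∈ interior K := by
    obtain ⟨q, hq, hAq, hBq, hXq⟩ := exists_orthPlane A B X₀
    have hlim : Tendsto (fun s : ℝ => M + s • (M - X₀)) (𝓝[>] 0) (𝓝 M) := by
      have : Continuous fun s : ℝ => M + s • (M - X₀) := by fun_prop
      have h := (this.tendsto 0).mono_left (nhdsWithin_le_nhds (s := Set.Ioi 0))
      simpa using h
    obtain ⟨s, hs, hs0⟩ := ((hlim.eventually (Metric.ball_mem_nhds M hRpos)).and
      self_mem_nhdsWithin).exists
    have hs0' : 0 < s := hs0
    have hWq : M + s • (M - X₀) ∈ orthPlane q := by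
      have h1 := hMq hAq hBq
      simp only [orthPlane, Set.mem_ofPred_eq] at *
      rw [inner_add_right, inner_smul_right, inner_sub_right, h1, hXq]
      ring
    have hW : M + s • (M - X₀) ∈ K := (bounds_of_diameter hK hconv hd hR hq ⟨hA, hAq⟩ ⟨hB, hBq⟩ hAB
      ⟨hX₀, hXq⟩ hWq).2 (mem_ball_iff_norm.1 hs)
    have := hconv.combo_self_interior_mem_interior hW hX₀ (a := 1 / (1 + s)) (b := s / (1 + s))
      (by positivity) (by positivity) (by field_simp)
    convert this using 1
    match_scalars <;> field_simp
    ring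
  -- Now M serves as the interior point in every plane through A and B, and these planes cover
  -- space.
  have hall : ∀ Z, (Z ∈ interior K → ‖Z - M‖ ≤ R) ∧ (‖Z - M‖ < R → Z ∈ K) := by
    intro Z
    obtain ⟨q, hq, hAq, hBq, hZq⟩ := exists_orthPlane A B Z
    exact bounds_of_diameter hK hconv hd hR hq ⟨hA, hAq⟩ ⟨hB, hBq⟩ hAB ⟨hMint, hMq hAq hBq⟩ hZq
  refine ⟨M, R, hRpos, Set.Subset.antisymm ?_ ?_⟩
  · rw [← hK.isClosed.closure_eq, ← hconv.closure_interior_eq_closure_of_nonempty_interior ⟨M, hMint⟩]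
    exact closure_minimal (fun Z hZ => mem_closedBall_iff_norm.2 ((hall Z).1 hZ))
      Metric.isClosed_closedBall
  · rw [← closure_ball M hRpos.ne']
    exact closure_minimal (fun Z hZ => (hall Z).2 (mem_ball_iff_norm.1 hZ)) hK.isClosed

theorem theorem1p4 (K : Set E3) (hK : IsCompact K) (hconv : Convex ℝ K) :
    IntegrableOn (fun P : E3 => sphereArea (solidAngle K P) ^ 2) Kᶜ volume ∧
    4 * Real.pi ^ 2 * (volume K).toReal ≤ ∫ P in Kᶜ, sphereArea (solidAngle K P) ^ 2 ∧
    ((∫ P in Kᶜ, sphereArea (solidAngle K P) ^ 2) = 4 * Real.pi ^ 2 * (volume K).toReal ↔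
      (∃ (c : E3) (r : ℝ), 0 < r ∧ K = Metric.closedBall c r) ∨ Collinear ℝ K) := by
  refine ⟨integrableOn_sphereArea_sq hK hconv, four_pi_sq_mul_volume_le_integral hK hconv,
    fun h => ?_, ?_⟩
  · rcases (interior K).eq_empty_or_nonempty with hi | hi
    · exact .inr (collinear_of_integral_eq_zero hK hconv hi h)
    · exact .inl (exists_closedBall_of_dense hK hconv hi
        (dense_isDiscSection hK hconv ((integral_eq_iff_ae hK hconv).1 h)))
  · rintro (⟨c, r, -, rfl⟩ | h)
    · exact integral_sphereArea_sq_closedBall c r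
    · exact integral_sphereArea_sq_of_collinear hK h
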